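/- Let $p$ be a prime, let $C$ be a field of characteristic $p$, let $D$ be a central division algebra over $C$ of degree $n$ (that is, $\dim_C D=n^2<\infty$; $D=C$ is allowed), and let $\delta:D\to D$ be a derivation, i.e. an additive map with $\delta(ab)=a\delta(b)+\delta(a)b$. Then $\delta(C)\subseteq C$. Put $F=\{c\in C:\delta(c)=0\}$, a subfield of $C$, and assume that the $F$-linear map $\delta|_C:C\to C$ has minimum polynomial $t^p-t$ over $F$. Let $D[t;\delta]$ be the ring of polynomials $\sum a_it^i$ ($a_i\in D$) with multiplication determined by $ta=at+\delta(a)$. For $b\in D$ let $V_p(b)\in D$ be defined by $(t-b)^p=t^p-V_p(b)$ in $D[t;\delta]$. Let $d\in D$ and $f=t^p-t-d\in D[t;\delta]$. Let $(D,\delta,d)=D[t;\delta]/D[t;\delta]f$ be the set of all $g\in D[t;\delta]$ of degree less than $p$, with the usual addition, with multiplication $g\circ h=$ the remainder $r$ of $gh$ on right division by $f$ ($gh=qf+r$, $\deg r<p$), and with $F$ acting by left multiplication on coefficients; it is a unital nonassociative $F$-algebra. A nonzero nonassociative algebra is called a division algebra if left and right multiplication by every nonzero element are bijective. Then: 1.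 $(D,\delta,d)$ has dimension $n^2p^2$ over $F$. 2. $(D,\delta,d)$ is a division algebra if and only if $d\neq V_p(z)-z$ for all $z\in D$; equivalently, if and only if $d\neq t^p-(t-z)^p-z$ in $D[t;\delta]$ for all $z\in D$. 3. If moreover $\delta^p=\delta$ on all of $D$, then $(D,\delta,d)$ is associative if and only if $d\in F$. 4. The map $G_{\mathrm{id},-1}:\sum a_it^i\mapsto\sum a_i(t-1)^i$ is an $F$-algebra automorphism of $(D,\delta,d)$ which is the identity on $D$ and generates a cyclic subgroup of order $p$ of $\mathrm{Aut}_F((D,\delta,d))$. -/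

import Mathlib

open Polynomial

noncomputable section

namespace DiffAlg

universe u v

/-- A derivation of a (not necessarily commutative) ring: an additive map with
`δ (a b) = a δ(b) + δ(a) b`. -/
structure RingDerivation (D : Type u) [Ring D] extends D →+ D where
  leibniz' : ∀ a b : D, toFun (a * b) = a * toFun b + toFun a * b

namespace RingDerivation

instance (D : Type u) [Ring D] : FunLike (RingDerivation D) D D where
  coe δ := δ.toFun
  coe_injective := by
    rintro ⟨⟨⟨f, _⟩, _⟩, _⟩ ⟨⟨⟨g, _⟩, _⟩, _⟩ h
    cases h
    rfl

instance (D : Type u) [Ring D] : AddMonoidHomClass (RingDerivation D) D D where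
  map_add δ := δ.map_add'
  map_zero δ := δ.map_zero'

variable {D : Type u} [Ring D] (δ : RingDerivation D)

theorem leibniz (a b : D) : δ (a * b) = a * δ b + δ a * b := δ.leibniz' a b

theorem map_one : δ 1 = 0 := by
  have h := δ.leibniz 1 1
  simpa using h

end RingDerivation

/-! ### The field of constants and the restriction to the centre -/

section Centre

variable (C : Type v) [Field C] {D : Type u} [DivisionRing D] [Algebra C D]
  (δ : RingDerivation D)

/-- `F = {c ∈ C | δ(c) = 0}`, a subfield of `C`. -/
def constants : Subfield C where
  carrier := {c | δ (algebraMap C D c) = 0}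
  zero_mem' := by simp
  one_mem' := by simp [δ.map_one]
  add_mem' := by
    intro a b ha hb
    simp only [Set.mem_ofPred_eq] at *
    simp [ha, hb]
  mul_mem' := by
    intro a b ha hb
    simp only [Set.mem_ofPred_eq] at *
    simp [δ.leibniz, ha, hb]
  neg_mem' := by
    intro a ha
    simp only [Set.mem_ofPred_eq] at *
    simp [ha]
  inv_mem' := by
    intro a ha
    simp only [Set.mem_ofPred_eq] at *
    by_cases h : a = 0
    · simp [h]
    have h1 := δ.leibniz (algebraMap C D a) (algebraMap C D a⁻¹)
    rw [← map_mul, mul_inv_cancel₀ h, _root_.map_one, δ.map_one, ha, zero_mul, add_zero] at h1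
    rcases mul_eq_zero.mp h1.symm with h2 | h2
    · exact absurd ((map_eq_zero _).mp h2) h
    · exact h2

theorem mem_constants {c : C} : c ∈ constants C δ ↔ δ (algebraMap C D c) = 0 := Iff.rfl

/-- A derivation maps the centre to itself. -/
theorem exists_algebraMap_eq [Algebra.IsCentral C D] (c : C) :
    ∃ c' : C, algebraMap C D c' = δ (algebraMap C D c) := by
  have h : δ (algebraMap C D c) ∈ Subalgebra.center C D := by
    rw [Subalgebra.mem_center_iff]
    intro b
    have h1 := δ.leibniz (algebraMap C D c) b
    have h2 := δ.leibniz b (algebraMap C D c)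
    rw [Algebra.commutes c b] at h1
    rw [h1, Algebra.commutes c (δ b), add_comm (δ b * _)] at h2
    exact (add_right_cancel h2).symm
  have h' := Algebra.IsCentral.out (K := C) (D := D) h
  exact Algebra.mem_bot.mp h'

/-- The restriction of `δ` to `C`, as a map. -/
def restrictFun [Algebra.IsCentral C D] (c : C) : C := (exists_algebraMap_eq C δ c).choose

theorem algebraMap_restrictFun [Algebra.IsCentral C D] (c : C) :
    algebraMap C D (restrictFun C δ c) = δ (algebraMap C D c) :=
  (exists_algebraMap_eq C δ c).choose_spec

/-- `δ|_C`, as an `F`-linear endomorphism of `C`. -/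
def restrictCentre [Algebra.IsCentral C D] : C →ₗ[constants C δ] C where
  toFun := restrictFun C δ
  map_add' a b := by
    apply (algebraMap C D).injective
    simp [algebraMap_restrictFun]
  map_smul' a b := by
    apply (algebraMap C D).injective
    have ha : δ (algebraMap C D (a : C)) = 0 := a.2
    simp [algebraMap_restrictFun, Subfield.smul_def, δ.leibniz, ha]

theorem algebraMap_restrictCentre [Algebra.IsCentral C D] (c : C) :
    algebraMap C D (restrictCentre C δ c) = δ (algebraMap C D c) :=
  (exists_algebraMap_eq C δ c).choose_spec

end Centre

/-! ### The differential polynomial ring -/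

section Ring

variable {D : Type u} [DivisionRing D] (δ : RingDerivation D)

/-- Left multiplication by `t` on polynomials with left coefficients:
`t (∑ aᵢ tⁱ) = ∑ aᵢ tⁱ⁺¹ + ∑ δ(aᵢ) tⁱ`. -/
def tMul : D[X] →+ D[X] where
  toFun g := g * X + g.sum fun i a => monomial i (δ a)
  map_zero' := by simp
  map_add' g h := by
    rw [Polynomial.sum_add_index g h _ (by simp) (by simp), add_mul]
    abel

theorem coeff_tMul (g : D[X]) (n : ℕ) :
    (tMul δ g).coeff n = (g * X).coeff n + δ (g.coeff n) := by
  change (g * X + g.sum fun i a => monomial i (δ a)).coeff n = _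
  rw [coeff_add, Polynomial.sum_def, finsetSum_coeff]
  congr 1
  simp only [coeff_monomial]
  rw [Finset.sum_ite_eq' g.support n]
  split_ifs with h
  · rfl
  · rw [notMem_support_iff.mp h, map_zero]

/-- The product of `D[t;δ]`: `(∑ aᵢ tⁱ) g = ∑ aᵢ (tⁱ g)`. -/
def mulFun (f g : D[X]) : D[X] := f.sum fun i a => Polynomial.C a * (tMul δ)^[i] g

theorem iterate_tMul_add (i : ℕ) (g h : D[X]) :
    (tMul δ)^[i] (g + h) = (tMul δ)^[i] g + (tMul δ)^[i] h := by
  induction i generalizing g h with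
  | zero => rfl
  | succ i ih => simp only [Function.iterate_succ, Function.comp, map_add, ih]

theorem mulFun_add_left (f g h : D[X]) : mulFun δ (f + g) h = mulFun δ f h + mulFun δ g h := by
  unfold mulFun
  rw [Polynomial.sum_add_index]
  · simp
  · intro i a b
    rw [map_add, add_mul]

theorem mulFun_add_right (f g h : D[X]) : mulFun δ f (g + h) = mulFun δ f g + mulFun δ f h := by
  unfold mulFun
  simp only [Polynomial.sum_def, iterate_tMul_add, mul_add, Finset.sum_add_distrib]

theorem mulFun_monomial (i : ℕ) (a : D) (g : D[X]) :
    mulFun δ (monomial i a) g = Polynomial.C a * (tMul δ)^[i] g := by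
  unfold mulFun
  rw [Polynomial.sum_monomial_index]
  simp

theorem zero_mulFun (g : D[X]) : mulFun δ 0 g = 0 := by simp [mulFun]

theorem mulFun_C_mul (a : D) (f g : D[X]) :
    mulFun δ (Polynomial.C a * f) g = Polynomial.C a * mulFun δ f g := by
  induction f using Polynomial.induction_on' with
  | add p q hp hq => rw [mul_add, mulFun_add_left, mulFun_add_left, mul_add, hp, hq]
  | monomial n b => rw [C_mul_monomial, mulFun_monomial, mulFun_monomial, map_mul, mul_assoc]

theorem tMul_C_mul (a : D) (g : D[X]) :
    tMul δ (Polynomial.C a * g) = Polynomial.C a * tMul δ g + Polynomial.C (δ a) * g := by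
  ext n
  simp only [coeff_tMul, coeff_add, coeff_C_mul, mul_assoc, δ.leibniz]
  rw [mul_add]
  abel

theorem tMul_monomial (i : ℕ) (a : D) :
    tMul δ (monomial i a) = monomial (i + 1) a + monomial i (δ a) := by
  change monomial i a * X + (monomial i a).sum (fun i a => monomial i (δ a)) = _
  rw [Polynomial.sum_monomial_index _ _ (by simp), monomial_mul_X]

theorem mulFun_tMul (f g : D[X]) : mulFun δ (tMul δ f) g = tMul δ (mulFun δ f g) := by
  induction f using Polynomial.induction_on' with
  | add p q hp hq => simp only [map_add, mulFun_add_left, hp, hq]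
  | monomial n b =>
    rw [tMul_monomial, mulFun_add_left, mulFun_monomial, mulFun_monomial, mulFun_monomial,
      tMul_C_mul, Function.iterate_succ_apply']

theorem mulFun_iterate_tMul (i : ℕ) (f g : D[X]) :
    mulFun δ ((tMul δ)^[i] f) g = (tMul δ)^[i] (mulFun δ f g) := by
  induction i with
  | zero => rfl
  | succ i ih => rw [Function.iterate_succ_apply', mulFun_tMul, ih, Function.iterate_succ_apply']

theorem mulFun_assoc (f g h : D[X]) : mulFun δ (mulFun δ f g) h = mulFun δ f (mulFun δ g h) := by
  induction f using Polynomial.induction_on' with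
  | add p q hp hq => simp only [mulFun_add_left, hp, hq]
  | monomial n b =>
    rw [mulFun_monomial, mulFun_monomial, mulFun_C_mul, mulFun_iterate_tMul]

theorem iterate_tMul_one (i : ℕ) : (tMul δ)^[i] 1 = X ^ i := by
  induction i with
  | zero => simp
  | succ i ih =>
    rw [Function.iterate_succ_apply', ih, ← monomial_one_right_eq_X_pow, tMul_monomial, δ.map_one,
      map_zero, add_zero, monomial_one_right_eq_X_pow]

theorem one_mulFun (g : D[X]) : mulFun δ 1 g = g := by
  have := mulFun_monomial δ 0 1 g
  simpa using this

theorem mulFun_one (f : D[X]) : mulFun δ f 1 = f := by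
  induction f using Polynomial.induction_on' with
  | add p q hp hq => rw [mulFun_add_left, hp, hq]
  | monomial n b => rw [mulFun_monomial, iterate_tMul_one, C_mul_X_pow_eq_monomial]

/-- The differential polynomial ring `D[t;δ]`: polynomials `∑ aᵢ tⁱ` with left coefficients in
`D`, termwise addition, and the multiplication determined by `t a = a t + δ(a)`. -/
def DiffPoly (_δ : RingDerivation D) : Type u := D[X]

namespace DiffPoly

variable {δ}

instance : AddCommGroup (DiffPoly δ) := inferInstanceAs (AddCommGroup D[X])

instance : Ring (DiffPoly δ) where
  __ := (inferInstance : AddCommGroup (DiffPoly δ))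
  mul f g := mulFun δ f g
  one := (1 : D[X])
  left_distrib := mulFun_add_right δ
  right_distrib := mulFun_add_left δ
  zero_mul := zero_mulFun δ
  mul_zero f := by
    have h := mulFun_add_right δ f 0 0
    rw [add_zero] at h
    exact left_eq_add.mp h
  mul_assoc := mulFun_assoc δ
  one_mul := one_mulFun δ
  mul_one := mulFun_one δ

/-- The underlying polynomial. -/
def toPoly : DiffPoly δ ≃+ D[X] := AddEquiv.refl _

theorem toPoly_mul (f g : DiffPoly δ) : toPoly (f * g) = mulFun δ (toPoly f) (toPoly g) := rfl

theorem toPoly_one : toPoly (1 : DiffPoly δ) = 1 := rfl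

variable (δ) in
/-- The constant polynomials, `D ⊆ D[t;δ]`. -/
def const : D →+* DiffPoly δ where
  toFun a := toPoly.symm (Polynomial.C a)
  map_zero' := Polynomial.C_0
  map_one' := Polynomial.C_1
  map_add' _ _ := Polynomial.C_add
  map_mul' a b := by
    apply toPoly.injective
    rw [toPoly_mul]
    change Polynomial.C (a * b) = mulFun δ (monomial 0 a) (Polynomial.C b)
    rw [mulFun_monomial]
    simp

variable (δ) in
/-- The indeterminate `t`. -/
def t : DiffPoly δ := toPoly.symm X

/-- The defining relation `t a = a t + δ(a)`. -/
theorem t_mul_const (a : D) : t δ * const δ a = const δ a * t δ + const δ (δ a) := by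
  apply toPoly.injective
  rw [map_add, toPoly_mul, toPoly_mul]
  change mulFun δ X (Polynomial.C a) = mulFun δ (monomial 0 a) X + Polynomial.C (δ a)
  rw [← monomial_one_one_eq_X, mulFun_monomial, mulFun_monomial]
  change _ * tMul δ (monomial 0 a) = _ * monomial 1 1 + _
  rw [tMul_monomial]
  simp [C_mul_monomial]

theorem toPoly_t_pow (k : ℕ) : toPoly (t δ ^ k) = X ^ k := by
  induction k with
  | zero => rw [pow_zero, pow_zero]; rfl
  | succ k ih =>
    rw [pow_succ', toPoly_mul, ih]
    change mulFun δ X (X ^ k) = _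
    rw [← iterate_tMul_one δ k, ← monomial_one_one_eq_X, mulFun_monomial,
      ← Function.iterate_add_apply, iterate_tMul_one, map_one, one_mul, monomial_one_one_eq_X]
    rw [add_comm]

/-- The degree of a differential polynomial, `-∞` for `0`. -/
def degree (g : DiffPoly δ) : WithBot ℕ := (toPoly g).degree

/-- `f` is monic. -/
def Monic (f : DiffPoly δ) : Prop := (toPoly f).Monic

/-- The degree as a natural number, `0` for `0`. -/
def natDegree (g : DiffPoly δ) : ℕ := (toPoly g).natDegree

variable (δ) in
/-- `G_{τ,a} (∑ aᵢ tⁱ) = ∑ τ(aᵢ) (t + a)ⁱ`. -/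
def G (τ : D ≃+* D) (a : D) (g : DiffPoly δ) : DiffPoly δ :=
  (toPoly g).sum fun i b => const δ (τ b) * (t δ + const δ a) ^ i

variable (δ) in
/-- `V_p(b)`, the element of `D` with `(t - b)^p = t^p - V_p(b)` when `D` has characteristic `p`,
obtained as the constant coefficient of `t^p - (t - b)^p`. -/
def V (p : ℕ) (b : D) : D := (toPoly (t δ ^ p - (t δ - const δ b) ^ p)).coeff 0

/-! ### Right division by a monic polynomial -/

theorem coeff_iterate_tMul {f : D[X]} (hf : f.Monic) (i : ℕ) :
    ((tMul δ)^[i] f).coeff (f.natDegree + i) = 1 ∧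
      ∀ n, f.natDegree + i < n → ((tMul δ)^[i] f).coeff n = 0 := by
  induction i with
  | zero => exact ⟨hf.coeff_natDegree, fun n hn => coeff_eq_zero_of_natDegree_lt hn⟩
  | succ i ih =>
    rw [Function.iterate_succ_apply']
    constructor
    · rw [coeff_tMul, ← add_assoc, coeff_mul_X, ih.1, ih.2 _ (Nat.lt_succ_self _), map_zero,
        add_zero]
    · intro n hn
      obtain ⟨k, rfl⟩ : ∃ k, n = k + 1 := ⟨n - 1, by omega⟩
      rw [coeff_tMul, coeff_mul_X, ih.2 k (by omega), ih.2 (k + 1) (by omega), map_zero, add_zero]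

/-- Existence in the right division algorithm. -/
theorem exists_rem {f : DiffPoly δ} (hf : f.Monic) (g : DiffPoly δ) :
    ∃ r : DiffPoly δ, degree r < (natDegree f : WithBot ℕ) ∧ ∃ q, g = q * f + r := by
  suffices H : ∀ (k : ℕ) (g : DiffPoly δ), degree g < (k : WithBot ℕ) →
      ∃ r : DiffPoly δ, degree r < (natDegree f : WithBot ℕ) ∧ ∃ q, g = q * f + r by
    apply H ((toPoly g).natDegree + 1)
    exact lt_of_le_of_lt degree_le_natDegree (by exact_mod_cast Nat.lt_succ_self _)
  intro k
  induction k with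
  | zero =>
    intro g hg
    refine ⟨g, lt_of_lt_of_le hg (by simp), 0, by rw [zero_mul, zero_add]⟩
  | succ k ih =>
    intro g hg
    by_cases hk : k + 1 ≤ natDegree f
    · exact ⟨g, lt_of_lt_of_le hg (by exact_mod_cast hk), 0, by rw [zero_mul, zero_add]⟩
    obtain ⟨j, hj⟩ : ∃ j, k = natDegree f + j := ⟨k - natDegree f, by omega⟩
    let q₀ : DiffPoly δ := toPoly.symm (monomial j ((toPoly g).coeff k))
    have hq : toPoly (q₀ * f) = Polynomial.C ((toPoly g).coeff k) * (tMul δ)^[j] (toPoly f) := by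
      rw [toPoly_mul]
      exact mulFun_monomial δ j _ _
    have hc := coeff_iterate_tMul (δ := δ) hf j
    obtain ⟨r, hr, q, hq'⟩ := ih (g - q₀ * f) (by
      refine (degree_lt_iff_coeff_zero _ _).mpr fun n hn => ?_
      rw [map_sub, coeff_sub, hq, coeff_C_mul]
      rcases hn.eq_or_lt with rfl | hn'
      · have := hc.1
        rw [show (toPoly f).natDegree + j = k from hj.symm] at this
        rw [this, mul_one, sub_self]
      · have := hc.2 n (by rw [show (toPoly f).natDegree + j = k from hj.symm]; exact hn')
        rw [this, mul_zero, sub_zero]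
        exact (degree_lt_iff_coeff_zero _ _).mp hg n hn')
    refine ⟨r, hr, q + q₀, ?_⟩
    rw [add_mul, add_right_comm, ← hq', sub_add_cancel]

theorem eq_zero_of_mul_degree_lt {f : DiffPoly δ} (hf : f.Monic) {q : DiffPoly δ}
    (h : degree (q * f) < (natDegree f : WithBot ℕ)) : q = 0 := by
  by_contra hq
  have hq' : toPoly q ≠ 0 := fun h => hq (toPoly.injective h)
  have h0 : (toPoly (q * f)).coeff (natDegree f + (toPoly q).natDegree) = 0 :=
    (degree_lt_iff_coeff_zero _ _).mp h _ (Nat.le_add_right _ _)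
  rw [toPoly_mul, mulFun, Polynomial.sum_def, finsetSum_coeff,
    Finset.sum_eq_single (toPoly q).natDegree] at h0
  · rw [coeff_C_mul, natDegree, (coeff_iterate_tMul hf _).1, mul_one] at h0
    exact hq' (leadingCoeff_eq_zero.mp h0)
  · intro i hi hne
    have : i < (toPoly q).natDegree := lt_of_le_of_ne (le_natDegree_of_mem_supp i hi) hne
    rw [coeff_C_mul, (coeff_iterate_tMul hf i).2 _ (by unfold natDegree; omega), mul_zero]
  · intro hn
    rw [notMem_support_iff.mp hn]
    simp

/-- Uniqueness in the right division algorithm. -/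
theorem rem_unique {f : DiffPoly δ} (hf : f.Monic) {r r' q q' : DiffPoly δ}
    (hr : degree r < (natDegree f : WithBot ℕ)) (hr' : degree r' < (natDegree f : WithBot ℕ))
    (h : q * f + r = q' * f + r') : r = r' := by
  have h1 : (q - q') * f = r' - r := by
    rw [sub_mul, sub_eq_sub_iff_add_eq_add, h]
    abel
  have h2 : q - q' = 0 := by
    apply eq_zero_of_mul_degree_lt hf
    rw [h1]
    exact lt_of_le_of_lt (degree_sub_le _ _) (max_lt hr' hr)
  rw [h2, zero_mul] at h1
  exact (sub_eq_zero.mp h1.symm).symm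

/-- `g mod_r f`: the remainder `r` of the right division `g = q f + r`, `deg r < deg f`. -/
def modR {f : DiffPoly δ} (hf : f.Monic) (g : DiffPoly δ) : DiffPoly δ := (exists_rem hf g).choose

theorem modR_degree {f : DiffPoly δ} (hf : f.Monic) (g : DiffPoly δ) :
    degree (modR hf g) < (natDegree f : WithBot ℕ) := (exists_rem hf g).choose_spec.1

theorem exists_modR {f : DiffPoly δ} (hf : f.Monic) (g : DiffPoly δ) :
    ∃ q, g = q * f + modR hf g := (exists_rem hf g).choose_spec.2

theorem modR_eq {f : DiffPoly δ} (hf : f.Monic) {g q r : DiffPoly δ}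
    (hr : degree r < (natDegree f : WithBot ℕ)) (h : g = q * f + r) : modR hf g = r := by
  obtain ⟨q', hq'⟩ := exists_modR hf g
  exact rem_unique hf (modR_degree hf g) hr (hq'.symm.trans h)

theorem modR_add {f : DiffPoly δ} (hf : f.Monic) (g h : DiffPoly δ) :
    modR hf (g + h) = modR hf g + modR hf h := by
  obtain ⟨q, hq⟩ := exists_modR hf g
  obtain ⟨q', hq'⟩ := exists_modR hf h
  refine modR_eq hf (q := q + q')
    (lt_of_le_of_lt (degree_add_le _ _) (max_lt (modR_degree hf g) (modR_degree hf h))) ?_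
  rw [add_mul, add_add_add_comm, ← hq, ← hq']

theorem modR_self {f : DiffPoly δ} (hf : f.Monic) {g : DiffPoly δ}
    (hg : degree g < (natDegree f : WithBot ℕ)) : modR hf g = g :=
  modR_eq hf (q := 0) hg (by rw [zero_mul, zero_add])

theorem modR_const_mul {f : DiffPoly δ} (hf : f.Monic) (a : D) (g : DiffPoly δ) :
    modR hf (const δ a * g) = const δ a * modR hf g := by
  obtain ⟨q, hq⟩ := exists_modR hf g
  refine modR_eq hf (q := const δ a * q) ?_ ?_
  · refine (degree_lt_iff_coeff_zero _ _).mpr fun n hn => ?_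
    have h0 := (degree_lt_iff_coeff_zero _ _).mp (modR_degree hf g) n hn
    change (mulFun δ (monomial 0 a) (toPoly (modR hf g))).coeff n = 0
    rw [mulFun_monomial, coeff_C_mul]
    simp [h0]
  · rw [mul_assoc, ← mul_add, ← hq]

end DiffPoly

/-! ### Petit algebras -/

open DiffPoly

variable {δ}

/-- `R_m = {g ∈ D[t;δ] | deg g < m}`. -/
def lowDegree (δ : RingDerivation D) (m : ℕ) : AddSubgroup (DiffPoly δ) where
  carrier := {g | DiffPoly.degree g < (m : WithBot ℕ)}
  zero_mem' := by
    change (0 : D[X]).degree < _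
    simp
  add_mem' ha hb := lt_of_le_of_lt (degree_add_le _ _) (max_lt ha hb)
  neg_mem' {a} ha := by
    change (-(toPoly a)).degree < _
    rw [degree_neg]
    exact ha

/-- The Petit algebra `S_f = D[t;δ]/D[t;δ]f` of a monic `f` of degree `m`: the additive group
`R_m` with the multiplication `g ∘ h = g h mod_r f`. -/
def Petit (f : DiffPoly δ) (_hf : f.Monic) : Type u := lowDegree δ (DiffPoly.natDegree f)

namespace Petit

variable {f : DiffPoly δ} {hf : f.Monic}

instance : AddCommGroup (Petit f hf) := inferInstanceAs (AddCommGroup (lowDegree δ (DiffPoly.natDegree f)))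

/-- The inclusion `S_f = R_m ⊆ D[t;δ]`, an additive map. -/
def val : Petit f hf →+ DiffPoly δ := (lowDegree δ (DiffPoly.natDegree f)).subtype

theorem val_injective : Function.Injective (val : Petit f hf →+ DiffPoly δ) := Subtype.val_injective

theorem degree_val (x : Petit f hf) : DiffPoly.degree x.val < (DiffPoly.natDegree f : WithBot ℕ) := x.2

/-- The class `g mod_r f` in `S_f` of a polynomial `g`. -/
def mk (g : DiffPoly δ) : Petit f hf := ⟨modR hf g, modR_degree hf g⟩

theorem val_mk (g : DiffPoly δ) : (mk g : Petit f hf).val = modR hf g := rfl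

instance : Mul (Petit f hf) := ⟨fun x y => mk (x.val * y.val)⟩

instance : One (Petit f hf) := ⟨mk 1⟩

theorem val_mul (x y : Petit f hf) : (x * y).val = modR hf (x.val * y.val) := rfl

theorem val_one : (1 : Petit f hf).val = modR hf 1 := rfl

theorem one_dichotomy (x : Petit f hf) : x = 0 ∨ (1 : Petit f hf).val = 1 := by
  by_cases h : DiffPoly.natDegree f = 0
  · left
    apply val_injective
    have := degree_val x
    rw [h] at this
    have h2 : toPoly x.val = 0 := by
      apply degree_eq_bot.mp
      have h3 : (toPoly x.val).degree < 0 := this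
      exact Nat.WithBot.lt_zero_iff.mp h3
    exact toPoly.injective h2
  · right
    refine modR_self hf ?_
    change (1 : D[X]).degree < ((DiffPoly.natDegree f : ℕ) : WithBot ℕ)
    rw [degree_one]
    exact_mod_cast Nat.pos_of_ne_zero h

instance : NonAssocRing (Petit f hf) where
  __ := (inferInstance : AddCommGroup (Petit f hf))
  left_distrib x y z := by
    apply val_injective
    rw [map_add, val_mul, val_mul, val_mul, map_add, mul_add, modR_add]
  right_distrib x y z := by
    apply val_injective
    rw [map_add, val_mul, val_mul, val_mul, map_add, add_mul, modR_add]
  zero_mul x := by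
    apply val_injective
    rw [val_mul, map_zero, zero_mul]
    exact modR_self hf (lowDegree δ (DiffPoly.natDegree f)).zero_mem
  mul_zero x := by
    apply val_injective
    rw [val_mul, map_zero, mul_zero]
    exact modR_self hf (lowDegree δ (DiffPoly.natDegree f)).zero_mem
  one_mul x := by
    apply val_injective
    rcases one_dichotomy x with rfl | h
    · rw [val_mul, map_zero, mul_zero]
      exact modR_self hf (lowDegree δ (DiffPoly.natDegree f)).zero_mem
    · rw [val_mul, h, one_mul, modR_self hf (degree_val x)]
  mul_one x := by
    apply val_injective
    rcases one_dichotomy x with rfl | h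
    · rw [val_mul, map_zero, zero_mul]
      exact modR_self hf (lowDegree δ (DiffPoly.natDegree f)).zero_mem
    · rw [val_mul, h, mul_one, modR_self hf (degree_val x)]

/-! `S_f` is a unital algebra over `F`, with `c ∑ aᵢ tⁱ = ∑ (c aᵢ) tⁱ`. -/

section Algebra

variable {C : Type v} [Field C] [Algebra C D]

instance : SMul (constants C δ) (Petit f hf) :=
  ⟨fun c x => mk (const δ (algebraMap C D c) * x.val)⟩

theorem val_smul (c : constants C δ) (x : Petit f hf) :
    (c • x).val = const δ (algebraMap C D c) * x.val := by
  change modR hf _ = _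
  rw [modR_const_mul, modR_self hf (degree_val x)]

instance : Module (constants C δ) (Petit f hf) where
  one_smul x := val_injective (by simp [val_smul])
  mul_smul a b x := val_injective (by simp [val_smul, mul_assoc])
  smul_zero a := val_injective (by simp [val_smul])
  smul_add a x y := val_injective (by simp [val_smul, mul_add])
  add_smul a b x := val_injective (by simp [val_smul, add_mul])
  zero_smul x := val_injective (by simp [val_smul])

theorem commute_const (c : constants C δ) (g : DiffPoly δ) :
    g * const δ (algebraMap C D c) = const δ (algebraMap C D c) * g := by
  have hc : δ (algebraMap C D (c : C)) = 0 := c.2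
  have key : ∀ P : D[X], mulFun δ P (Polynomial.C (algebraMap C D c)) =
      Polynomial.C (algebraMap C D c) * P := by
    intro P
    induction P using Polynomial.induction_on' with
    | add p q hp hq => rw [mulFun_add_left, hp, hq, mul_add]
    | monomial n b =>
      rw [mulFun_monomial]
      have : (tMul δ)^[n] (Polynomial.C (algebraMap C D c)) =
          Polynomial.C (algebraMap C D (c : C)) * X ^ n := by
        rw [← iterate_tMul_one δ n]
        have h : ∀ g : D[X], tMul δ (Polynomial.C (algebraMap C D (c : C)) * g) =
            Polynomial.C (algebraMap C D (c : C)) * tMul δ g := by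
          intro g
          rw [tMul_C_mul, hc]
          simp
        clear * - h
        induction n with
        | zero => simp
        | succ n ih => rw [Function.iterate_succ_apply', ih, h, Function.iterate_succ_apply']
      rw [this, ← mul_assoc, ← map_mul, ← Algebra.commutes, C_mul_X_pow_eq_monomial,
        C_mul_monomial]
  apply toPoly.injective
  rw [toPoly_mul, toPoly_mul]
  refine (key (toPoly g)).trans ?_
  change _ = mulFun δ (monomial 0 _) _
  rw [mulFun_monomial]
  rfl

instance : IsScalarTower (constants C δ) (Petit f hf) (Petit f hf) where
  smul_assoc c x y := val_injective (by
    simp only [smul_eq_mul, val_smul, val_mul, mul_assoc, modR_const_mul])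

instance : SMulCommClass (constants C δ) (Petit f hf) (Petit f hf) where
  smul_comm c x y := val_injective (by
    simp only [smul_eq_mul, val_smul, val_mul]
    rw [← mul_assoc, commute_const, mul_assoc, modR_const_mul])

end Algebra

end Petit

/-! ### The algebra `(D, δ, d)` -/

theorem monic_diffExt (δ : RingDerivation D) (p : ℕ) [Fact p.Prime] (d : D) :
    (t δ ^ p - t δ - const δ d).Monic := by
  unfold DiffPoly.Monic
  rw [map_sub, map_sub, toPoly_t_pow]
  change (X ^ p - X - Polynomial.C d).Monic
  rw [sub_sub]
  apply monic_X_pow_sub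
  have hp := (Fact.out : p.Prime).two_le
  refine lt_of_le_of_lt (degree_add_le _ _) (max_lt ?_ ?_)
  · rw [degree_X]
    exact_mod_cast hp
  · exact lt_of_le_of_lt degree_C_le (by exact_mod_cast (by omega : 0 < p))

/-- `(D, δ, d) = D[t;δ]/D[t;δ]f` with `f = t^p - t - d`. -/
abbrev GenDiffAlg (δ : RingDerivation D) (p : ℕ) [Fact p.Prime] (d : D) : Type u :=
  Petit (t δ ^ p - t δ - const δ d) (monic_diffExt δ p d)

end Ring

/-! ### Nonassociative algebras -/

/-- A nonzero nonassociative ring in which all left and right multiplications with nonzero elements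
are bijective. -/
def IsDivisionAlgebra (A : Type u) [NonAssocRing A] : Prop :=
  Nontrivial A ∧ ∀ a : A, a ≠ 0 →
    Function.Bijective (fun x => a * x) ∧ Function.Bijective (fun x => x * a)

/-- Associativity of the multiplication. -/
def IsAssociativeAlgebra (A : Type u) [NonAssocRing A] : Prop :=
  ∀ x y z : A, x * y * z = x * (y * z)

/-- `Aut_F(A)`, the group of `F`-algebra automorphisms of a nonassociative algebra `A`. -/
def Aut (F : Type v) (A : Type u) [Field F] [NonAssocRing A] [Module F A] :
    Subgroup (A ≃ₗ[F] A) where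
  carrier := {φ | ∀ x y, φ (x * y) = φ x * φ y}
  one_mem' _ _ := rfl
  mul_mem' {φ ψ} hφ hψ x y := by
    change φ (ψ (x * y)) = φ (ψ x) * φ (ψ y)
    rw [hψ, hφ]
  inv_mem' {φ} hφ x y := by
    apply φ.injective
    change φ (φ.symm (x * y)) = φ (φ.symm x * φ.symm y)
    rw [hφ]
    simp

end DiffAlg

end


/-!
The algebra `S = (D, δ, d)` is the quotient of the left module `D[t;δ]` by `D[t;δ]f`. If this module
is simple, then right multiplication by a nonzero `y` is surjective already on polynomials of degree
less than any `x` with `x y = 0`, so `S` has no zero divisors. The translation `t ↦ t - 1` fixes `f`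
and acts semilinearly on `S`; since `g(t - 1) - g(t)` has smaller degree than `g`, no proper nonzero
submodule is invariant under it. Hence `S` is a sum of minimal submodules of a common `D`-dimension,
and as `dim_D S = p` is prime, either `S` is simple or it has a submodule of codimension one. In the
latter case the submodule contains the class of some `t - z`, which makes `t - z` a right factor of
`f`, and the remainder of `f` on division by `t - z` is `V_p(z) - z - d`.
-/

noncomputable section

namespace DiffAlg

/-! ### Coefficients, translations and `p`-th powers in `D[t;δ]` -/

namespace DiffPoly

variable {D : Type*} [DivisionRing D] {δ : RingDerivation D}

/-- `D[t;δ]` as a left vector space over `D`, through left multiplication by constants. -/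
instance : Module D (DiffPoly δ) := Module.compHom _ (const δ)

/-- The coefficient of `t ^ n`, as an additive map. -/
def coeff (n : ℕ) : DiffPoly δ →+ D := (lcoeff D n).toAddMonoidHom.comp toPoly.toAddMonoidHom

theorem coeff_apply (n : ℕ) (g : DiffPoly δ) : coeff n g = (toPoly g).coeff n := rfl

theorem ext_coeff {g h : DiffPoly δ} (H : ∀ n, coeff n g = coeff n h) : g = h :=
  toPoly.injective (Polynomial.ext H)

theorem coeff_const (a : D) (n : ℕ) : coeff n (const δ a) = if n = 0 then a else 0 :=
  Polynomial.coeff_C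

theorem coeff_t_pow (k n : ℕ) : coeff n (t δ ^ k) = if n = k then 1 else 0 := by
  rw [coeff_apply, toPoly_t_pow, coeff_X_pow]

theorem toPoly_const_mul (a : D) (g : DiffPoly δ) :
    toPoly (const δ a * g) = Polynomial.C a * toPoly g :=
  mulFun_monomial δ 0 a (toPoly g)

theorem toPoly_t_mul (g : DiffPoly δ) : toPoly (t δ * g) = tMul δ (toPoly g) := by
  have h := mulFun_monomial δ 1 1 (toPoly g)
  rwa [monomial_one_one_eq_X, map_one, one_mul] at h

theorem coeff_const_mul (a : D) (g : DiffPoly δ) (n : ℕ) :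
    coeff n (const δ a * g) = a * coeff n g := by
  rw [coeff_apply, toPoly_const_mul, coeff_C_mul, coeff_apply]

theorem coeff_t_mul_succ (g : DiffPoly δ) (n : ℕ) :
    coeff (n + 1) (t δ * g) = coeff n g + δ (coeff (n + 1) g) := by
  rw [coeff_apply, toPoly_t_mul, coeff_tMul, coeff_mul_X, coeff_apply, coeff_apply]

@[elab_as_elim]
theorem induction_on {P : DiffPoly δ → Prop} (g : DiffPoly δ)
    (add : ∀ g h, P g → P h → P (g + h)) (const_mul_t_pow : ∀ a k, P (const δ a * t δ ^ k)) :
    P g :=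
  Polynomial.induction_on' (motive := fun q : D[X] => P (toPoly.symm q)) (toPoly g)
    (fun _ _ hq hr => add _ _ hq hr) fun k a => by
      rw [← C_mul_X_pow_eq_monomial, ← toPoly_t_pow (δ := δ), ← toPoly_const_mul,
        AddEquiv.symm_apply_apply]
      exact const_mul_t_pow a k

theorem const_injective : Function.Injective (const δ) := fun _ _ h => C_injective h

theorem charP_diffPoly (δ : RingDerivation D) (p : ℕ) [CharP D p] : CharP (DiffPoly δ) p :=
  charP_of_injective_ringHom const_injective p

section Lift

variable {S : Type*} [Ring S]

/-- The additive map `∑ bᵢ tⁱ ↦ ∑ φ(bᵢ) sⁱ` out of `D[t;δ]`. -/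
def evalHom (φ : D →+* S) (s : S) : DiffPoly δ →+ S where
  toFun g := (toPoly g).sum fun i b => φ b * s ^ i
  map_zero' := by rw [map_zero, sum_zero_index]
  map_add' g h := by
    rw [map_add, sum_add_index] <;> simp [add_mul]

theorem evalHom_const_mul_t_pow (φ : D →+* S) (s : S) (b : D) (k : ℕ) :
    evalHom (δ := δ) φ s (const δ b * t δ ^ k) = φ b * s ^ k := by
  change (toPoly (const δ b * t δ ^ k)).sum (fun i b => φ b * s ^ i) = _
  rw [toPoly_const_mul, toPoly_t_pow, C_mul_X_pow_eq_monomial, sum_monomial_index _ _ (by simp)]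

theorem evalHom_const_mul (φ : D →+* S) (s : S) (a : D) (g : DiffPoly δ) :
    evalHom φ s (const δ a * g) = φ a * evalHom φ s g := by
  induction g using induction_on with
  | add g h hg hh => rw [mul_add, map_add, hg, hh, map_add, mul_add]
  | const_mul_t_pow b k =>
    rw [← mul_assoc, ← map_mul, evalHom_const_mul_t_pow, evalHom_const_mul_t_pow, map_mul,
      mul_assoc]

theorem evalHom_t_mul (φ : D →+* S) (s : S) (hs : ∀ a, s * φ a = φ a * s + φ (δ a))
    (g : DiffPoly δ) : evalHom φ s (t δ * g) = s * evalHom φ s g := by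
  induction g using induction_on with
  | add g h hg hh => rw [mul_add, map_add, hg, hh, map_add, mul_add]
  | const_mul_t_pow b k =>
    rw [← mul_assoc, t_mul_const, add_mul, mul_assoc, ← pow_succ', map_add]
    simp only [evalHom_const_mul_t_pow]
    rw [← mul_assoc, hs, add_mul, mul_assoc, ← pow_succ']

/-- The universal property of `D[t;δ]`: a ring homomorphism `φ` out of `D` extends to `D[t;δ]` by
any image `s` of `t` that satisfies the defining relation. -/
def lift (φ : D →+* S) (s : S) (hs : ∀ a, s * φ a = φ a * s + φ (δ a)) : DiffPoly δ →+* S where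
  __ := evalHom φ s
  map_one' := by simpa using evalHom_const_mul_t_pow (δ := δ) φ s 1 0
  map_mul' g h := by
    change evalHom φ s (g * h) = evalHom φ s g * evalHom φ s h
    induction g using induction_on with
    | add g g' hg hg' => rw [add_mul, map_add, hg, hg', map_add, add_mul]
    | const_mul_t_pow b k =>
      rw [mul_assoc, evalHom_const_mul, evalHom_const_mul_t_pow, mul_assoc]
      congr 1
      induction k with
      | zero => simp
      | succ k ih => rw [pow_succ', mul_assoc, evalHom_t_mul φ s hs, ih, pow_succ', mul_assoc]

theorem lift_const (φ : D →+* S) (s : S) (hs : ∀ a, s * φ a = φ a * s + φ (δ a)) (a : D) :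
    lift φ s hs (const δ a) = φ a := by
  change evalHom φ s (const δ a) = φ a
  simpa using evalHom_const_mul_t_pow (δ := δ) φ s a 0

theorem lift_t (φ : D →+* S) (s : S) (hs : ∀ a, s * φ a = φ a * s + φ (δ a)) :
    lift φ s hs (t δ) = s := by
  change evalHom φ s (t δ) = s
  simpa using evalHom_const_mul_t_pow (δ := δ) φ s 1 1

theorem ringHom_ext {φ ψ : DiffPoly δ →+* S} (hconst : ∀ a, φ (const δ a) = ψ (const δ a))
    (ht : φ (t δ) = ψ (t δ)) : φ = ψ := by
  ext g
  induction g using induction_on with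
  | add g h hg hh => rw [map_add, map_add, hg, hh]
  | const_mul_t_pow a k => simp only [map_mul, map_pow, hconst, ht]

end Lift

section Translate

/-- The endomorphism `t ↦ t + a` of `D[t;δ]`, for `a` central in `D`. -/
def translateHom (a : Subring.center D) : DiffPoly δ →+* DiffPoly δ :=
  lift (const δ) (t δ + const δ a) fun b => by
    rw [add_mul, mul_add, t_mul_const, ← map_mul, ← map_mul, Subring.mem_center_iff.mp a.2 b]
    abel

theorem translateHom_const (a : Subring.center D) (b : D) :
    translateHom a (const δ b) = const δ b := lift_const _ _ _ _

theorem translateHom_t (a : Subring.center D) : translateHom a (t δ) = t δ + const δ a :=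
  lift_t _ _ _

theorem translateHom_comp (a b : Subring.center D) :
    (translateHom a).comp (translateHom b) = translateHom (δ := δ) (a + b) :=
  ringHom_ext (by simp [translateHom_const]) (by
    simp [translateHom_const, translateHom_t, add_assoc])

theorem translateHom_zero : translateHom (δ := δ) (0 : Subring.center D) = RingHom.id _ :=
  ringHom_ext (by simp [translateHom_const]) (by simp [translateHom_t])

/-- The automorphism `t ↦ t + a` of `D[t;δ]`, for `a` central in `D`. -/
def translate (a : Subring.center D) : DiffPoly δ ≃+* DiffPoly δ :=
  RingEquiv.ofRingHom (translateHom a) (translateHom (-a))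
    (by rw [translateHom_comp, add_neg_cancel, translateHom_zero])
    (by rw [translateHom_comp, neg_add_cancel, translateHom_zero])

protected theorem translate_zero (g : DiffPoly δ) : translate 0 g = g :=
  RingHom.congr_fun translateHom_zero g

protected theorem translate_translate (a b : Subring.center D) (g : DiffPoly δ) :
    translate a (translate b g) = translate (a + b) g :=
  RingHom.congr_fun (translateHom_comp a b) g

theorem translate_const (a : Subring.center D) (b : D) : translate a (const δ b) = const δ b :=
  translateHom_const a b

theorem translate_t (a : Subring.center D) : translate a (t δ) = t δ + const δ a :=
  translateHom_t a

theorem translate_neg_one_t : translate (-1) (t δ) = t δ - 1 := by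
  rw [translate_t, Subring.coe_neg, Subring.coe_one, map_neg, map_one, sub_eq_add_neg]

end Translate

section LowDegree

variable {g : DiffPoly δ} {m : ℕ}

theorem mem_lowDegree_iff : g ∈ lowDegree δ m ↔ ∀ n, m ≤ n → coeff n g = 0 :=
  Polynomial.degree_lt_iff_coeff_zero _ _

theorem lowDegree_mono : Monotone (lowDegree δ) := fun _ _ hm _ hg =>
  mem_lowDegree_iff.mpr fun n hn => mem_lowDegree_iff.mp hg n (hm.trans hn)

theorem exists_mem_lowDegree_succ (g : DiffPoly δ) : ∃ m, g ∈ lowDegree δ (m + 1) :=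
  ⟨natDegree g, mem_lowDegree_iff.mpr fun _ hn => coeff_eq_zero_of_natDegree_lt hn⟩

theorem mem_lowDegree_of_coeff_eq_zero (hg : g ∈ lowDegree δ (m + 1)) (h : coeff m g = 0) :
    g ∈ lowDegree δ m :=
  mem_lowDegree_iff.mpr fun n hn => hn.eq_or_lt.elim (fun hmn => hmn ▸ h)
    fun hmn => mem_lowDegree_iff.mp hg n hmn

theorem const_coeff_zero (hg : g ∈ lowDegree δ 1) : const δ (coeff 0 g) = g :=
  ext_coeff fun n => by
    rw [coeff_const]
    split_ifs with hn
    · rw [hn]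
    · exact (mem_lowDegree_iff.mp hg n (Nat.one_le_iff_ne_zero.mpr hn)).symm

theorem t_pow_mem_lowDegree_succ (k : ℕ) : t δ ^ k ∈ lowDegree δ (k + 1) :=
  mem_lowDegree_iff.mpr fun n hn => by rw [coeff_t_pow, if_neg (by lia)]

theorem t_mem_lowDegree_two : t δ ∈ lowDegree δ 2 := pow_one (t δ) ▸ t_pow_mem_lowDegree_succ 1

theorem const_mul_mem_lowDegree (a : D) (hg : g ∈ lowDegree δ m) :
    const δ a * g ∈ lowDegree δ m :=
  mem_lowDegree_iff.mpr fun n hn => by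
    rw [coeff_const_mul, mem_lowDegree_iff.mp hg n hn, mul_zero]

theorem t_mul_mem_lowDegree_succ (hg : g ∈ lowDegree δ m) : t δ * g ∈ lowDegree δ (m + 1) :=
  mem_lowDegree_iff.mpr fun n hn => by
    obtain ⟨n, rfl⟩ := Nat.exists_eq_add_of_le' (Nat.one_le_of_lt hn)
    rw [coeff_t_mul_succ, mem_lowDegree_iff.mp hg n (by lia),
      mem_lowDegree_iff.mp hg (n + 1) (by lia), map_zero, add_zero]

theorem sub_leading_mem_lowDegree (hg : g ∈ lowDegree δ (m + 1)) :
    g - const δ (coeff m g) * t δ ^ m ∈ lowDegree δ m :=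
  mem_lowDegree_of_coeff_eq_zero
    (sub_mem hg (const_mul_mem_lowDegree _ (t_pow_mem_lowDegree_succ m)))
    (by rw [map_sub, coeff_const_mul, coeff_t_pow, if_pos rfl, mul_one, sub_self])

theorem linear_pow_sub_t_pow_mem_lowDegree (a : D) (k : ℕ) :
    (t δ + const δ a) ^ k - t δ ^ k ∈ lowDegree δ k := by
  induction k with
  | zero => simp only [pow_zero, sub_self, zero_mem]
  | succ k ih =>
    have hk : (t δ + const δ a) ^ k ∈ lowDegree δ (k + 1) :=
      (sub_add_cancel ((t δ + const δ a) ^ k) (t δ ^ k)) ▸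
        add_mem (lowDegree_mono k.le_succ ih) (t_pow_mem_lowDegree_succ k)
    have hsplit : (t δ + const δ a) ^ (k + 1) - t δ ^ (k + 1) =
        t δ * ((t δ + const δ a) ^ k - t δ ^ k) + const δ a * (t δ + const δ a) ^ k := by
      rw [pow_succ', pow_succ', add_mul, mul_sub]
      abel
    rw [hsplit]
    exact add_mem (t_mul_mem_lowDegree_succ ih) (const_mul_mem_lowDegree a hk)

theorem coeff_linear_pow_self (a : D) (k : ℕ) : coeff k ((t δ + const δ a) ^ k) = 1 := by
  have h := mem_lowDegree_iff.mp (linear_pow_sub_t_pow_mem_lowDegree (δ := δ) a k) k le_rfl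
  rwa [map_sub, coeff_t_pow, if_pos rfl, sub_eq_zero] at h

theorem coeff_linear_pow_succ (a : D) (k : ℕ) :
    coeff k ((t δ + const δ a) ^ (k + 1)) = ((k + 1 : ℕ) : D) * a := by
  induction k with
  | zero =>
    have ht : coeff 0 (t δ) = 0 := by simpa using coeff_t_pow (δ := δ) 1 0
    simp [ht, coeff_const]
  | succ k ih =>
    rw [pow_succ', add_mul, map_add, coeff_t_mul_succ, ih, coeff_const_mul,
      coeff_linear_pow_self, δ.map_one]
    push_cast
    simp only [add_mul, add_zero, mul_one, one_mul]

theorem translate_sub_self_eq (a : Subring.center D) (c : D) (k : ℕ) (g : DiffPoly δ) :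
    translate a g - g = const δ c * ((t δ + const δ a) ^ k - t δ ^ k) +
      (translate a (g - const δ c * t δ ^ k) - (g - const δ c * t δ ^ k)) := by
  rw [map_sub, map_mul, map_pow, translate_t, translate_const, mul_sub]
  abel

theorem translate_sub_self_mem_lowDegree (a : Subring.center D) (hg : g ∈ lowDegree δ (m + 1)) :
    translate a g - g ∈ lowDegree δ m := by
  induction m generalizing g with
  | zero =>
    rw [← const_coeff_zero hg, translate_const, sub_self]
    exact zero_mem _
  | succ m ih =>
    rw [translate_sub_self_eq a (coeff (m + 1) g) (m + 1) g]
    exact add_mem (const_mul_mem_lowDegree _ (linear_pow_sub_t_pow_mem_lowDegree _ _))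
      (lowDegree_mono m.le_succ (ih (sub_leading_mem_lowDegree hg)))

theorem translate_mem_lowDegree (a : Subring.center D) (hg : g ∈ lowDegree δ m) :
    translate a g ∈ lowDegree δ m := by
  rw [← sub_add_cancel (translate a g) g]
  exact add_mem (translate_sub_self_mem_lowDegree a (lowDegree_mono m.le_succ hg)) hg

theorem coeff_translate_sub_self (a : Subring.center D) (hg : g ∈ lowDegree δ (m + 2)) :
    coeff m (translate a g - g) = coeff (m + 1) g * (((m + 1 : ℕ) : D) * a) := by
  have hlow := translate_sub_self_mem_lowDegree a (sub_leading_mem_lowDegree hg)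
  rw [translate_sub_self_eq a (coeff (m + 1) g) (m + 1) g, map_add,
    mem_lowDegree_iff.mp hlow m le_rfl, add_zero, coeff_const_mul, map_sub,
    coeff_linear_pow_succ, coeff_t_pow, if_neg m.succ_ne_self.symm, sub_zero]

end LowDegree

section CharP

variable (p : ℕ) [Fact p.Prime] [CharP D p]

include p in
theorem mem_lowDegree_one_of_translate_eq {a : Subring.center D} (ha : a ≠ 0) {g : DiffPoly δ}
    (hg : g ∈ lowDegree δ p) (hfix : translate a g = g) : g ∈ lowDegree δ 1 := by
  suffices H : ∀ m < p, g ∈ lowDegree δ (m + 1) → g ∈ lowDegree δ 1 from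
    H (p - 1) (Nat.sub_one_lt (Fact.out : p.Prime).ne_zero)
      (by rwa [Nat.sub_add_cancel (Fact.out : p.Prime).one_le])
  intro m hmp hm
  induction m with
  | zero => exact hm
  | succ m ih =>
    have hcoeff := coeff_translate_sub_self a hm
    rw [hfix, sub_self, map_zero] at hcoeff
    have hne : ((m + 1 : ℕ) : D) ≠ 0 := fun h =>
      Nat.not_dvd_of_pos_of_lt m.succ_pos hmp ((CharP.cast_eq_zero_iff D p _).mp h)
    have ha' : (a : D) ≠ 0 := fun h => ha (Subtype.ext h)
    have hzero : coeff (m + 1) g = 0 :=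
      (mul_eq_zero.mp hcoeff.symm).resolve_right (mul_ne_zero hne ha')
    exact ih (by lia) (mem_lowDegree_of_coeff_eq_zero hm hzero)

/-- `t ^ p - (t - b) ^ p` has degree less than `p` and is invariant under `t ↦ t - 1`, hence it is
constant. -/
theorem sub_const_pow_char (b : D) : (t δ - const δ b) ^ p = t δ ^ p - const δ (V δ p b) := by
  have := charP_diffPoly δ p
  suffices h : t δ ^ p - (t δ - const δ b) ^ p ∈ lowDegree δ 1 by
    have hV : const δ (V δ p b) = t δ ^ p - (t δ - const δ b) ^ p := const_coeff_zero h
    rw [hV, sub_sub_cancel]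
  refine mem_lowDegree_one_of_translate_eq p (a := -1) (neg_ne_zero.mpr one_ne_zero) ?_ ?_
  · rw [← neg_sub, sub_eq_add_neg (t δ), ← map_neg]
    exact neg_mem (linear_pow_sub_t_pow_mem_lowDegree (-b) p)
  · rw [map_sub, map_pow, map_pow, map_sub, translate_const, translate_neg_one_t,
      sub_right_comm, sub_pow_char_of_commute p (Commute.one_right _),
      sub_pow_char_of_commute p (Commute.one_right _), sub_sub_sub_cancel_right]

theorem t_pow_char_mul_const (a : D) :
    t δ ^ p * const δ a = const δ a * t δ ^ p + const δ (δ^[p] a) := by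
  let ad := LinearMap.mulLeft ℤ (t δ) - LinearMap.mulRight ℤ (t δ)
  have ad_pow (k : ℕ) : (ad ^ k) (const δ a) = const δ (δ^[k] a) := by
    induction k with
    | zero => rfl
    | succ k ih =>
      rw [pow_succ', Module.End.mul_apply, ih, Function.iterate_succ_apply', LinearMap.sub_apply,
        LinearMap.mulLeft_apply, LinearMap.mulRight_apply, t_mul_const, add_sub_cancel_left]
  have := charP_diffPoly δ p
  have : CharP (Module.End ℤ (DiffPoly δ)) p :=
    charP_of_injective_ringHom (f := (Algebra.lmul ℤ (DiffPoly δ)).toRingHom)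
      Algebra.lmul_injective p
  have ad_pow_char : ad ^ p = LinearMap.mulLeft ℤ (t δ ^ p) - LinearMap.mulRight ℤ (t δ ^ p) := by
    rw [sub_pow_char_of_commute p (LinearMap.commute_mulLeft_right (t δ) (t δ)),
      LinearMap.pow_mulLeft, LinearMap.pow_mulRight]
  rw [← ad_pow, ad_pow_char, LinearMap.sub_apply, LinearMap.mulLeft_apply,
    LinearMap.mulRight_apply, add_sub_cancel]

end CharP

end DiffPoly

/-! ### Modules with a symmetry that fixes no proper submodule -/

section Semisimple

open Module

variable (D : Type*) {R M : Type*} [DivisionRing D] [Ring R] [AddCommGroup M] [Module D R]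
  [Module D M] [Module R M] [IsScalarTower D R M] [FiniteDimensional D M]

theorem finrank_sup_eq_add_of_disjoint {U S : Submodule R M} (h : Disjoint U S) :
    finrank D ↥(U ⊔ S) = finrank D U + finrank D S := by
  have hsum := Submodule.finrank_sup_add_finrank_inf_eq (U.restrictScalars D) (S.restrictScalars D)
  rwa [← Submodule.restrictScalars_inf, h.eq_bot, Submodule.restrictScalars_bot, finrank_bot,
    add_zero, ← Submodule.restrictScalars_sup] at hsum

theorem exists_finrank_add_mul_eq_of_sSup_eq_top {X : Set (Submodule R M)} {m : ℕ}
    (hatom : ∀ S ∈ X, IsAtom S) (hfinrank : ∀ S ∈ X, finrank D S = m) (htop : sSup X = ⊤)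
    (U : Submodule R M) : ∃ k, finrank D U + k * m = finrank D M := by
  have : IsNoetherian R M := isNoetherian_of_tower D inferInstance
  induction U using WellFoundedGT.induction with | _ U ih
  rcases eq_or_ne U ⊤ with rfl | hU
  · exact ⟨0, by rw [zero_mul, add_zero]; exact finrank_top D M⟩
  obtain ⟨S, hS, hSU⟩ : ∃ S ∈ X, ¬ S ≤ U := by
    by_contra! hle
    exact hU (top_unique (htop ▸ sSup_le hle))
  obtain ⟨k, hk⟩ := ih (U ⊔ S) (left_lt_sup.mpr hSU)
  rw [finrank_sup_eq_add_of_disjoint D ((hatom S hS).not_le_iff_disjoint.mp hSU).symm,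
    hfinrank S hS] at hk
  exact ⟨k + 1, by rw [← hk]; ring⟩

/-- The minimal submodules of a given dimension span an invariant submodule, so `M` is a direct sum
of simple submodules of equal dimension. -/
theorem isSimpleModule_or_exists_finrank_add_one (e : Submodule R M ≃o Submodule R M)
    (hfinrank : ∀ N, finrank D (e N) = finrank D N) (hfixed : ∀ N, e N = N → N = ⊥ ∨ N = ⊤)
    (hprime : (finrank D M).Prime) :
    IsSimpleModule R M ∨ ∃ W : Submodule R M, finrank D W + 1 = finrank D M := by
  have : IsNoetherian R M := isNoetherian_of_tower D inferInstance
  have : IsArtinian R M := isArtinian_of_tower D inferInstance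
  have : Nontrivial M := nontrivial_of_finrank_pos hprime.pos
  obtain ⟨S, hS⟩ := IsAtomic.exists_atom (Submodule R M)
  let X : Set (Submodule R M) := {T | IsAtom T ∧ finrank D T = finrank D S}
  have hX_invariant : e '' X = X := by
    refine (e.toEquiv.image_eq_preimage_symm X).trans (Set.ext fun T => and_congr ?_ ?_)
    · exact e.symm.isAtom_iff T
    · exact Eq.congr_left ((hfinrank (e.symm T)).symm.trans (by rw [e.apply_symm_apply]))
  have hX_top : sSup X = ⊤ := by
    refine (hfixed _ ?_).resolve_left fun hbot => hS.1 (le_bot_iff.mp (hbot ▸ le_sSup ⟨hS, rfl⟩))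
    rw [e.map_sSup, ← sSup_image, hX_invariant]
  have hexists := exists_finrank_add_mul_eq_of_sSup_eq_top D (fun _ hT => hT.1) (fun _ hT => hT.2)
    hX_top
  obtain ⟨k, hk⟩ := hexists ⊥
  rw [finrank_zero_of_subsingleton, zero_add] at hk
  rcases (Nat.dvd_prime hprime).mp (Dvd.intro_left k hk) with hone | hfull
  · obtain ⟨N, hN⟩ := IsCoatomic.exists_coatom (Submodule R M)
    obtain ⟨T, hT, hTN⟩ : ∃ T ∈ X, ¬ T ≤ N := by
      by_contra! hle
      exact hN.1 (top_unique (hX_top ▸ sSup_le hle))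
    refine Or.inr ⟨N, ?_⟩
    rw [← hone, ← hT.2, ← finrank_sup_eq_add_of_disjoint D
      (hT.1.not_le_iff_disjoint.mp hTN).symm, hN.2 _ (left_lt_sup.mpr hTN)]
    exact finrank_top D M
  · have hS_top : S = ⊤ := by
      have := Submodule.eq_top_of_finrank_eq (K := D) (S := S.restrictScalars D) hfull
      exact (Submodule.restrictScalars_eq_top_iff D R M).mp this
    exact Or.inl (isSimpleModule_iff R M |>.mpr (isSimpleOrder_iff_isAtom_top.mpr (hS_top ▸ hS)))

theorem exists_sub_smul_mem_of_finrank_add_one {W : Submodule R M}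
    (hW : finrank D W + 1 = finrank D M) {x : M} (hx : x ∉ W) (y : M) :
    ∃ c : D, y - c • x ∈ W := by
  have hquot : finrank D (M ⧸ W.restrictScalars D) = 1 := by
    have := Submodule.finrank_quotient_add_finrank (W.restrictScalars D)
    change _ + finrank D W = _ at this
    lia
  have hx' : (W.restrictScalars D).mkQ x ≠ 0 := fun h =>
    hx ((Submodule.Quotient.mk_eq_zero (W.restrictScalars D)).mp h)
  obtain ⟨c, hc⟩ := exists_smul_eq_of_finrank_eq_one hquot hx' ((W.restrictScalars D).mkQ y)
  refine ⟨c, ?_⟩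
  rw [← map_smul] at hc
  exact (Submodule.Quotient.eq (W.restrictScalars D)).mp hc.symm

end Semisimple

open DiffPoly

/-! ### Petit algebras as modules over `D[t;δ]` -/

theorem DiffPoly.exists_monic_const_mul {D : Type*} [DivisionRing D] {δ : RingDerivation D}
    {g : DiffPoly δ} (hg : g ≠ 0) :
    ∃ a : D, (const δ a * g).Monic ∧ DiffPoly.natDegree (const δ a * g) = DiffPoly.natDegree g := by
  have hlead : (toPoly g).leadingCoeff ≠ 0 :=
    leadingCoeff_ne_zero.mpr fun h => hg (toPoly.injective h)
  refine ⟨(toPoly g).leadingCoeff⁻¹, ?_, ?_⟩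
  · rw [DiffPoly.Monic, toPoly_const_mul, Polynomial.Monic, leadingCoeff_mul, leadingCoeff_C,
      inv_mul_cancel₀ hlead]
  · rw [DiffPoly.natDegree, toPoly_const_mul, natDegree_C_mul (inv_ne_zero hlead),
      DiffPoly.natDegree]

theorem DiffPoly.Monic.t_pow_sub_mem_lowDegree {D : Type*} [DivisionRing D]
    {δ : RingDerivation D} {f : DiffPoly δ} (hf : f.Monic) :
    t δ ^ DiffPoly.natDegree f - f ∈ lowDegree δ (DiffPoly.natDegree f) := by
  refine mem_lowDegree_iff.mpr fun n hn => ?_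
  rw [map_sub, coeff_t_pow, coeff_apply]
  rcases hn.eq_or_lt with rfl | hlt
  · rw [if_pos rfl, sub_eq_zero]
    exact hf.coeff_natDegree.symm
  · rw [if_neg hlt.ne', coeff_eq_zero_of_natDegree_lt hlt, sub_zero]

namespace Petit

variable {D : Type*} [DivisionRing D] {δ : RingDerivation D} {f : DiffPoly δ} {hf : f.Monic}

theorem val_mem_lowDegree (x : Petit f hf) : x.val ∈ lowDegree δ (DiffPoly.natDegree f) := x.2

theorem mk_val (x : Petit f hf) : mk x.val = x := val_injective (modR_self hf x.degree_val)

theorem val_mk_of_mem_lowDegree {g : DiffPoly δ} (hg : g ∈ lowDegree δ (DiffPoly.natDegree f)) :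
    (mk g : Petit f hf).val = g := modR_self hf hg

theorem mk_add (g h : DiffPoly δ) : (mk (g + h) : Petit f hf) = mk g + mk h :=
  val_injective (by rw [map_add]; exact modR_add hf g h)

theorem mk_mul_add (q r : DiffPoly δ) : (mk (q * f + r) : Petit f hf) = mk r := by
  obtain ⟨q', hq'⟩ := exists_modR hf r
  refine val_injective (modR_eq hf (q := q + q') (modR_degree hf r) ?_)
  rw [add_mul, add_assoc, val_mk, ← hq']

theorem mk_mul_val_mk (g h : DiffPoly δ) : (mk (g * (mk h : Petit f hf).val) : Petit f hf) =
    mk (g * h) := by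
  obtain ⟨q, hq⟩ := exists_modR hf h
  conv_rhs => rw [hq, mul_add, ← mul_assoc, mk_mul_add]
  rfl

theorem mk_zero : (mk 0 : Petit f hf) = 0 :=
  val_injective (by rw [val_mk_of_mem_lowDegree (zero_mem _), map_zero])

/-- `S_f` is the quotient of the left module `D[t;δ]` by the left ideal generated by `f`. -/
instance : Module (DiffPoly δ) (Petit f hf) where
  smul g x := mk (g * x.val)
  one_smul x := by
    change mk (1 * x.val) = x
    rw [one_mul, mk_val]
  mul_smul g h x := by
    change mk (g * h * x.val) = mk (g * (mk (h * x.val)).val)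
    rw [mk_mul_val_mk, mul_assoc]
  smul_zero g := by
    change mk (g * val 0) = 0
    rw [map_zero, mul_zero, mk_zero]
  smul_add g x y := by
    change mk (g * (x + y).val) = mk (g * x.val) + mk (g * y.val)
    rw [map_add, mul_add, mk_add]
  add_smul g h x := by
    change mk ((g + h) * x.val) = mk (g * x.val) + mk (h * x.val)
    rw [add_mul, mk_add]
  zero_smul x := by
    change mk (0 * x.val) = 0
    rw [zero_mul, mk_zero]

theorem smul_def (g : DiffPoly δ) (x : Petit f hf) : g • x = mk (g * x.val) := rfl

theorem mul_eq_val_smul (x y : Petit f hf) : x * y = x.val • y := rfl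

theorem smul_mk (g h : DiffPoly δ) : g • (mk h : Petit f hf) = mk (g * h) := mk_mul_val_mk g h

theorem val_smul_one (x : Petit f hf) : x.val • (1 : Petit f hf) = x := by
  rw [← mul_eq_val_smul, mul_one]

theorem smul_one_eq_mk (g : DiffPoly δ) : g • (1 : Petit f hf) = mk g :=
  (smul_mk g 1).trans (by rw [mul_one])

theorem self_smul_one : f • (1 : Petit f hf) = 0 := by
  have h := mk_mul_add (hf := hf) 1 0
  rwa [one_mul, add_zero, mk_zero, ← smul_one_eq_mk] at h

instance : Module D (Petit f hf) := Module.compHom _ (const δ)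

theorem const_smul (a : D) (x : Petit f hf) : const δ a • x = a • x := rfl

theorem val_const_smul (a : D) (x : Petit f hf) : (a • x).val = const δ a * x.val :=
  val_mk_of_mem_lowDegree (const_mul_mem_lowDegree a x.val_mem_lowDegree)

instance : IsScalarTower D (DiffPoly δ) (Petit f hf) := ⟨fun a g x => mul_smul (const δ a) g x⟩

instance : IsScalarTower D (Petit f hf) (Petit f hf) :=
  ⟨fun a x y => by
    rw [smul_eq_mul, smul_eq_mul, mul_eq_val_smul, val_const_smul, mul_smul, const_smul,
      mul_eq_val_smul]⟩

instance {C : Type*} [Field C] [Algebra C D] : IsScalarTower (constants C δ) D (Petit f hf) :=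
  ⟨fun c a x => val_injective (by
    rw [val_smul, val_const_smul, val_const_smul, ← mul_assoc, ← map_mul, Subfield.smul_def,
      Algebra.smul_def])⟩

/-- `S_f` as the left `D`-vector space of polynomials of degree less than `deg f`. -/
def equivDegreeLT : Petit f hf ≃ₗ[D] degreeLT D (DiffPoly.natDegree f) where
  toFun x := ⟨toPoly x.val, mem_degreeLT.mpr x.degree_val⟩
  invFun g := ⟨toPoly.symm g.1, mem_degreeLT.mp g.2⟩
  map_add' _ _ := rfl
  map_smul' a x := Subtype.ext (by
    simp only [val_const_smul, toPoly_const_mul, C_mul', RingHom.id_apply, Submodule.coe_smul])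

instance : Module.Finite D (Petit f hf) :=
  Module.Finite.equiv (equivDegreeLT.trans (degreeLTEquiv D _)).symm

theorem finrank_eq_natDegree : Module.finrank D (Petit f hf) = DiffPoly.natDegree f := by
  rw [(equivDegreeLT.trans (degreeLTEquiv D _)).finrank_eq, Module.finrank_fin_fun]

theorem noZeroDivisors_of_isSimpleModule [IsSimpleModule (DiffPoly δ) (Petit f hf)] :
    NoZeroDivisors (Petit f hf) where
  eq_zero_or_eq_zero_of_mul_eq_zero {x y} hxy := by
    by_contra! hne
    obtain ⟨a, hmonic, hdegree⟩ := exists_monic_const_mul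
      ((map_ne_zero_iff val val_injective).mpr hne.1)
    have hkill : (const δ a * x.val) • y = 0 := by
      rw [mul_smul, ← mul_eq_val_smul, hxy, smul_zero]
    have hsurj : Function.Surjective (LinearMap.mulRight D y) := fun z => by
      obtain ⟨g, rfl⟩ := IsSimpleModule.toSpanSingleton_surjective (DiffPoly δ) hne.2 z
      obtain ⟨r, hr, q, rfl⟩ := exists_rem hmonic g
      have hr_mem : r ∈ lowDegree δ (DiffPoly.natDegree f) := by
        have hx : DiffPoly.natDegree x.val ≤ DiffPoly.natDegree f :=
          natDegree_le_of_degree_le (degree_val x).le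
        exact lowDegree_mono hx (hdegree ▸ hr)
      refine ⟨mk r, ?_⟩
      rw [LinearMap.mulRight_apply, mul_eq_val_smul, val_mk_of_mem_lowDegree hr_mem,
        LinearMap.toSpanSingleton_apply, add_smul, mul_smul, hkill, smul_zero, zero_add]
    exact hne.1 ((LinearMap.injective_iff_surjective.mpr hsurj) (by simpa using hxy))

theorem exists_mul_eq_zero_of_eq_mul {g h : DiffPoly δ} (hgh : f = g * h)
    (hg : g ∈ lowDegree δ (DiffPoly.natDegree f)) (hh : h ∈ lowDegree δ (DiffPoly.natDegree f)) :
    ∃ x y : Petit f hf, x ≠ 0 ∧ y ≠ 0 ∧ x * y = 0 := by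
  have hf_ne : f ≠ 0 := fun h => Polynomial.Monic.ne_zero hf (by rw [h, map_zero])
  refine ⟨mk g, mk h, fun hx => hf_ne ?_, fun hy => hf_ne ?_, ?_⟩
  · rw [hgh, ← val_mk_of_mem_lowDegree (hf := hf) hg, hx, map_zero, zero_mul]
  · rw [hgh, ← val_mk_of_mem_lowDegree (hf := hf) hh, hy, map_zero, mul_zero]
  · rw [mul_eq_val_smul, val_mk_of_mem_lowDegree hg, smul_mk, ← hgh, ← smul_one_eq_mk,
      self_smul_one]

/-- Both sides say that `f` generates a two-sided ideal. -/
theorem isAssociativeAlgebra_iff_forall_smul_eq_zero (h : 2 ≤ DiffPoly.natDegree f) :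
    IsAssociativeAlgebra (Petit f hf) ↔ ∀ z : Petit f hf, f • z = 0 := by
  constructor
  · intro hassoc z
    obtain ⟨k, hk⟩ : ∃ k, DiffPoly.natDegree f = k + 1 := Nat.exists_eq_add_of_le' (by lia)
    have hx : (mk (t δ ^ k) : Petit f hf).val = t δ ^ k :=
      val_mk_of_mem_lowDegree (hk ▸ t_pow_mem_lowDegree_succ k)
    have hy : (mk (t δ) : Petit f hf).val = t δ :=
      val_mk_of_mem_lowDegree (lowDegree_mono h t_mem_lowDegree_two)
    have hxy : (mk (t δ ^ k) * mk (t δ) : Petit f hf).val = t δ ^ (k + 1) - f := by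
      have hmod := mk_mul_add (hf := hf) 1 (t δ ^ (k + 1) - f)
      rw [one_mul, add_sub_cancel] at hmod
      rw [mul_eq_val_smul, hx, smul_mk, ← pow_succ, hmod]
      exact val_mk_of_mem_lowDegree (hk ▸ hf.t_pow_sub_mem_lowDegree)
    have hsmul := hassoc (mk (t δ ^ k)) (mk (t δ)) z
    rw [mul_eq_val_smul, hxy, mul_eq_val_smul, mul_eq_val_smul, hx, hy, ← mul_smul, ← pow_succ,
      sub_smul, sub_eq_self] at hsmul
    exact hsmul
  · intro hf_smul x y z
    obtain ⟨q, hq⟩ := exists_modR hf (x.val * y.val)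
    rw [← val_mul] at hq
    rw [mul_eq_val_smul (x * y) z, mul_eq_val_smul x (y * z), mul_eq_val_smul y z, ← mul_smul, hq,
      add_smul, mul_smul, hf_smul, smul_zero, zero_add]

section Translate

instance (a : Subring.center D) :
    RingHomInvPair (DiffPoly.translate (δ := δ) a : DiffPoly δ →+* DiffPoly δ)
      ((DiffPoly.translate (δ := δ) a).symm : DiffPoly δ →+* DiffPoly δ) :=
  .of_ringEquiv _

instance (a : Subring.center D) :
    RingHomInvPair ((DiffPoly.translate (δ := δ) a).symm : DiffPoly δ →+* DiffPoly δ)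
      (DiffPoly.translate (δ := δ) a : DiffPoly δ →+* DiffPoly δ) :=
  .of_ringEquiv_symm _

variable {a : Subring.center D} (hfix : DiffPoly.translate a f = f)

include hfix in
theorem modR_translate (g : DiffPoly δ) :
    modR hf (DiffPoly.translate a g) = DiffPoly.translate a (modR hf g) := by
  obtain ⟨q, hq⟩ := exists_modR hf g
  refine modR_eq hf (q := DiffPoly.translate a q) (translate_mem_lowDegree a (modR_degree hf g)) ?_
  conv_lhs => rw [hq, map_add, map_mul, hfix]

/-- The translation `t ↦ t + a` on `S_f`, when it fixes `f`. It is semilinear over the translation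
of `D[t;δ]`. -/
def translateEquiv :
    Petit f hf ≃ₛₗ[(DiffPoly.translate (δ := δ) a : DiffPoly δ →+* DiffPoly δ)] Petit f hf where
  toFun x := ⟨DiffPoly.translate a x.val, translate_mem_lowDegree a x.2⟩
  invFun x := ⟨(DiffPoly.translate a).symm x.val, translate_mem_lowDegree (-a) x.2⟩
  left_inv x := val_injective ((DiffPoly.translate a).symm_apply_apply x.val)
  right_inv x := val_injective ((DiffPoly.translate a).apply_symm_apply x.val)
  map_add' x y := val_injective (map_add (DiffPoly.translate a) x.val y.val)
  map_smul' g x := val_injective (by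
    change DiffPoly.translate a (modR hf (g * x.val)) =
      modR hf (DiffPoly.translate a g * DiffPoly.translate a x.val)
    rw [← modR_translate hfix, map_mul])

theorem val_translateEquiv (x : Petit f hf) :
    (translateEquiv hfix x).val = DiffPoly.translate a x.val := rfl

theorem translateEquiv_mul (x y : Petit f hf) :
    translateEquiv hfix (x * y) = translateEquiv hfix x * translateEquiv hfix y :=
  map_smulₛₗ (translateEquiv hfix) x.val y

theorem translateEquiv_const_smul (b : D) (x : Petit f hf) :
    translateEquiv hfix (b • x) = b • translateEquiv hfix x := by
  rw [← const_smul, map_smulₛₗ, RingEquiv.coe_toRingHom, translate_const, const_smul]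

theorem finrank_map_translateEquiv (W : Submodule (DiffPoly δ) (Petit f hf)) :
    Module.finrank D (W.map (translateEquiv hfix).toLinearMap) = Module.finrank D W := by
  let e : Petit f hf ≃ₗ[D] Petit f hf :=
    { translateEquiv hfix with map_smul' := translateEquiv_const_smul hfix }
  exact e.finrank_map_eq (W.restrictScalars D)

theorem eq_top_of_one_mem {W : Submodule (DiffPoly δ) (Petit f hf)} (h : 1 ∈ W) : W = ⊤ :=
  eq_top_iff.mpr fun x _ => val_smul_one x ▸ W.smul_mem x.val h

theorem eq_top_of_val_mem_lowDegree_one {W : Submodule (DiffPoly δ) (Petit f hf)} {x : Petit f hf}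
    (hxW : x ∈ W) (hx : x ≠ 0) (hconst : x.val ∈ lowDegree δ 1) : W = ⊤ := by
  obtain ⟨c, hc⟩ : ∃ c, x.val = const δ c := ⟨_, (const_coeff_zero hconst).symm⟩
  have hne : c ≠ 0 := fun h => hx (val_injective (by rw [hc, h, map_zero, map_zero]))
  have hone : const δ c⁻¹ • x = 1 := by
    rw [← val_smul_one x, ← mul_smul, hc, ← map_mul, inv_mul_cancel₀ hne, map_one, one_smul]
  exact eq_top_of_one_mem (hone ▸ W.smul_mem _ hxW)

include hfix in
/-- `translate x - x` has smaller degree than `x` and lies in the same invariant submodule. -/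
theorem eq_bot_or_eq_top_of_translateEquiv_mem (p : ℕ) [Fact p.Prime] [CharP D p] (ha : a ≠ 0)
    (hdegree : DiffPoly.natDegree f ≤ p) {W : Submodule (DiffPoly δ) (Petit f hf)}
    (hW : ∀ x ∈ W, translateEquiv hfix x ∈ W) : W = ⊥ ∨ W = ⊤ := by
  refine or_iff_not_imp_left.mpr fun hbot => ?_
  obtain ⟨x, hxW, hx⟩ := W.ne_bot_iff.mp hbot
  obtain ⟨m, hm⟩ := exists_mem_lowDegree_succ x.val
  induction m generalizing x with
  | zero => exact eq_top_of_val_mem_lowDegree_one hxW hx hm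
  | succ m ih =>
    by_cases hx_fixed : translateEquiv hfix x - x = 0
    · refine eq_top_of_val_mem_lowDegree_one hxW hx (mem_lowDegree_one_of_translate_eq p ha
        (lowDegree_mono hdegree x.val_mem_lowDegree) ?_)
      rw [← val_translateEquiv hfix, sub_eq_zero.mp hx_fixed]
    · refine ih _ (sub_mem (hW x hxW) hxW) hx_fixed ?_
      rw [map_sub, val_translateEquiv]
      exact translate_sub_self_mem_lowDegree a hm

end Translate

end Petit

/-! ### The polynomial `t ^ p - t - d` -/

namespace DiffPoly

variable {D : Type*} [DivisionRing D] (δ : RingDerivation D) (p : ℕ) (d : D)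

theorem artinSchreier_mul_t : (t δ ^ p - t δ - const δ d) * t δ =
    t δ * (t δ ^ p - t δ - const δ d) + const δ (δ d) := by
  rw [sub_mul, sub_mul, mul_sub, mul_sub, t_mul_const, ← pow_succ, ← pow_succ']
  abel

variable [Fact p.Prime]

theorem natDegree_artinSchreier : DiffPoly.natDegree (t δ ^ p - t δ - const δ d) = p := by
  have hp : (1 : WithBot ℕ) < p := mod_cast (Fact.out : p.Prime).one_lt
  have hdegree : (X + Polynomial.C d).degree < (X ^ p : D[X]).degree := by
    rwa [degree_X_add_C, degree_X_pow]
  rw [DiffPoly.natDegree, map_sub, map_sub, toPoly_t_pow, sub_sub]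
  change (X ^ p - (X + Polynomial.C d)).natDegree = p
  rw [natDegree_eq_of_degree_eq (degree_sub_eq_left_of_degree_lt hdegree), natDegree_X_pow]

variable [CharP D p]

theorem artinSchreier_mul_const (a : D) : (t δ ^ p - t δ - const δ d) * const δ a =
    const δ a * (t δ ^ p - t δ - const δ d) + const δ (δ^[p] a - δ a - (d * a - a * d)) := by
  rw [sub_mul, sub_mul, t_pow_char_mul_const, t_mul_const, map_sub, map_sub, map_sub, map_mul,
    map_mul]
  noncomm_ring

theorem translate_artinSchreier : DiffPoly.translate (-1) (t δ ^ p - t δ - const δ d) =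
    t δ ^ p - t δ - const δ d := by
  have := charP_diffPoly δ p
  rw [map_sub, map_sub, map_pow, translate_neg_one_t, translate_const,
    sub_pow_char_of_commute p (Commute.one_right _), one_pow, sub_sub_sub_cancel_right]

theorem artinSchreier_eq_mul_add (z : D) : t δ ^ p - t δ - const δ d =
    ((t δ - const δ z) ^ (p - 1) - 1) * (t δ - const δ z) + const δ (V δ p z - z - d) := by
  have hp : p - 1 + 1 = p := Nat.succ_pred_prime Fact.out
  rw [sub_mul, ← pow_succ, hp, sub_const_pow_char, map_sub, map_sub]
  noncomm_ring

end DiffPoly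

theorem isDivisionAlgebra_iff_noZeroDivisors (F : Type*) {A : Type*} [Field F] [NonAssocRing A]
    [Module F A] [IsScalarTower F A A] [SMulCommClass F A A] [FiniteDimensional F A] :
    IsDivisionAlgebra A ↔ Nontrivial A ∧ NoZeroDivisors A := by
  refine and_congr_right fun _ => ⟨fun h => ⟨fun {x y} hxy => ?_⟩, fun _ a ha => ⟨?_, ?_⟩⟩
  · exact or_iff_not_imp_left.mpr fun hx => (h x hx).1.1 (hxy.trans (mul_zero x).symm)
  · have hinj : Function.Injective (LinearMap.mulLeft F a) := mul_right_injective₀ ha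
    exact ⟨hinj, LinearMap.injective_iff_surjective.mp hinj⟩
  · have hinj : Function.Injective (LinearMap.mulRight F a) := mul_left_injective₀ ha
    exact ⟨hinj, LinearMap.injective_iff_surjective.mp hinj⟩

namespace GenDiffAlg

variable {D : Type*} [DivisionRing D] {δ : RingDerivation D} {p : ℕ} [Fact p.Prime] {d : D}

theorem finrank_eq : Module.finrank D (GenDiffAlg δ p d) = p :=
  Petit.finrank_eq_natDegree.trans (natDegree_artinSchreier δ p d)

instance : Nontrivial (GenDiffAlg δ p d) :=
  Module.nontrivial_of_finrank_pos (R := D) (by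
    rw [finrank_eq]
    exact (Fact.out : p.Prime).pos)

variable [CharP D p]

theorem eq_V_sub_of_sub_const_smul_one_mem {W : Submodule (DiffPoly δ) (GenDiffAlg δ p d)}
    (hW : W ≠ ⊤) {z : D} (hz : (t δ - const δ z) • (1 : GenDiffAlg δ p d) ∈ W) :
    d = V δ p z - z := by
  have hsplit := congrArg (· • (1 : GenDiffAlg δ p d)) (artinSchreier_eq_mul_add δ p d z)
  simp only [Petit.self_smul_one, add_smul, mul_smul, Petit.const_smul] at hsplit
  have hrem : (V δ p z - z - d) • (1 : GenDiffAlg δ p d) ∈ W := by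
    rw [eq_neg_of_add_eq_zero_right hsplit.symm]
    exact neg_mem (W.smul_mem _ hz)
  by_contra hne
  refine hW (Petit.eq_top_of_one_mem ?_)
  rw [← inv_smul_smul₀ (sub_ne_zero.mpr (Ne.symm hne)) (1 : GenDiffAlg δ p d)]
  exact W.smul_mem (const δ _) hrem

theorem isSimpleModule_of_forall_ne_V_sub (h : ∀ z, d ≠ V δ p z - z) :
    IsSimpleModule (DiffPoly δ) (GenDiffAlg δ p d) := by
  have hfix := translate_artinSchreier δ p d
  have hp : (Module.finrank D (GenDiffAlg δ p d)).Prime := by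
    rw [finrank_eq]
    exact Fact.out
  refine (isSimpleModule_or_exists_finrank_add_one D
    (Submodule.orderIsoMapComap (Petit.translateEquiv hfix)) (Petit.finrank_map_translateEquiv hfix)
    (fun W hW => ?_) hp).resolve_right ?_
  · exact Petit.eq_bot_or_eq_top_of_translateEquiv_mem hfix p (neg_ne_zero.mpr one_ne_zero)
      (natDegree_artinSchreier δ p d).le fun x hx => hW.le (Submodule.mem_map_of_mem hx)
  · rintro ⟨W, hW⟩
    have hW_top : W ≠ ⊤ := by
      rintro rfl
      exact Nat.succ_ne_self _ (hW.trans (finrank_top D (GenDiffAlg δ p d)).symm)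
    obtain ⟨z, hz⟩ := exists_sub_smul_mem_of_finrank_add_one D hW
      (fun hone => hW_top (Petit.eq_top_of_one_mem hone)) (t δ • 1)
    exact h z (eq_V_sub_of_sub_const_smul_one_mem hW_top (by rwa [sub_smul]))

theorem exists_mul_eq_zero (z : D) :
    ∃ x y : GenDiffAlg δ p (V δ p z - z), x ≠ 0 ∧ y ≠ 0 ∧ x * y = 0 := by
  have hp := (Fact.out : p.Prime).two_le
  have hlow (k : ℕ) (hk : k < p) : (t δ - const δ z) ^ k ∈ lowDegree δ p := by
    have hlinear : (t δ - const δ z) ^ k = (t δ + const δ (-z)) ^ k - t δ ^ k + t δ ^ k := by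
      rw [sub_add_cancel, map_neg, sub_eq_add_neg]
    rw [hlinear]
    exact add_mem (lowDegree_mono hk.le (linear_pow_sub_t_pow_mem_lowDegree _ k))
      (lowDegree_mono hk (t_pow_mem_lowDegree_succ k))
  refine Petit.exists_mul_eq_zero_of_eq_mul (g := (t δ - const δ z) ^ (p - 1) - 1)
    (h := t δ - const δ z) ?_ ?_ ?_
  · rw [artinSchreier_eq_mul_add δ p _ z, sub_self, map_zero, add_zero]
  · rw [natDegree_artinSchreier]
    exact sub_mem (hlow (p - 1) (by lia)) (pow_zero (t δ - const δ z) ▸ hlow 0 (by lia))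
  · rw [natDegree_artinSchreier]
    exact pow_one (t δ - const δ z) ▸ hlow 1 (by lia)

theorem isDivisionAlgebra_iff {C : Type*} [Field C] [Algebra C D]
    [FiniteDimensional (constants C δ) D] :
    IsDivisionAlgebra (GenDiffAlg δ p d) ↔ ∀ z, d ≠ V δ p z - z := by
  have : FiniteDimensional (constants C δ) (GenDiffAlg δ p d) := Module.Finite.trans D _
  rw [isDivisionAlgebra_iff_noZeroDivisors (constants C δ)]
  refine ⟨?_, fun h => ⟨inferInstance, ?_⟩⟩
  · rintro ⟨-, _⟩ z rfl
    obtain ⟨x, y, hx, hy, hxy⟩ := exists_mul_eq_zero (δ := δ) (p := p) z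
    exact mul_ne_zero hx hy hxy
  · have := isSimpleModule_of_forall_ne_V_sub h
    exact Petit.noZeroDivisors_of_isSimpleModule

theorem forall_artinSchreier_smul_eq_zero_iff :
    (∀ x : GenDiffAlg δ p d, (t δ ^ p - t δ - const δ d) • x = 0) ↔
      δ d = 0 ∧ ∀ a, δ^[p] a - δ a = d * a - a * d := by
  have hmod {g : DiffPoly δ} {b : D} (h : (t δ ^ p - t δ - const δ d) * g =
      g * (t δ ^ p - t δ - const δ d) + const δ b) :
      (t δ ^ p - t δ - const δ d) • g • (1 : GenDiffAlg δ p d) = b • 1 := by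
    rw [← mul_smul, h, add_smul, mul_smul, Petit.self_smul_one, smul_zero, zero_add,
      Petit.const_smul]
  constructor
  · intro h
    have hzero {b : D} (hb : 0 = b • (1 : GenDiffAlg δ p d)) : b = 0 :=
      (smul_eq_zero.mp hb.symm).resolve_right one_ne_zero
    exact ⟨hzero ((h _).symm.trans (hmod (artinSchreier_mul_t δ p d))), fun a => sub_eq_zero.mp
      (hzero ((h _).symm.trans (hmod (artinSchreier_mul_const δ p d a))))⟩
  · rintro ⟨hd, ha⟩ x
    have hcommute (g : DiffPoly δ) : Commute (t δ ^ p - t δ - const δ d) g := by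
      induction g using DiffPoly.induction_on with
      | add g h hg hh => exact hg.add_right hh
      | const_mul_t_pow a k =>
        refine Commute.mul_right ?_ (Commute.pow_right ?_ k)
        · rw [Commute, SemiconjBy, artinSchreier_mul_const, ha, sub_self, map_zero, add_zero]
        · rw [Commute, SemiconjBy, artinSchreier_mul_t, hd, map_zero, add_zero]
    rw [← Petit.val_smul_one x, ← mul_smul, hcommute x.val, mul_smul, Petit.self_smul_one,
      smul_zero]

theorem isAssociativeAlgebra_iff : IsAssociativeAlgebra (GenDiffAlg δ p d) ↔
    δ d = 0 ∧ ∀ a, δ^[p] a - δ a = d * a - a * d := by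
  rw [Petit.isAssociativeAlgebra_iff_forall_smul_eq_zero
    ((Fact.out : p.Prime).two_le.trans_eq (natDegree_artinSchreier δ p d).symm),
    forall_artinSchreier_smul_eq_zero_iff]

end GenDiffAlg

/-! ### The degree of `C` over `F` -/

section Eigenspace

variable {K V : Type*} [Field K] [AddCommGroup V] [Module K V]

theorem ker_aeval_prod_of_pairwise_isCoprime {ι : Type*} (f : Module.End K V) {q : ι → K[X]}
    {s : Finset ι} (hq : (s : Set ι).Pairwise fun i j => IsCoprime (q i) (q j)) :
    LinearMap.ker (aeval f (∏ i ∈ s, q i)) = ⨆ i ∈ s, LinearMap.ker (aeval f (q i)) := by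
  classical
  induction s using Finset.induction_on with
  | empty => simp [Module.End.one_eq_id]
  | insert i s hi ih =>
    rw [Finset.coe_insert, Set.pairwise_insert_of_notMem (mod_cast hi)] at hq
    rw [Finset.prod_insert hi, Finset.iSup_insert, ← ih hq.1,
      sup_ker_aeval_eq_ker_aeval_mul_of_coprime]
    exact IsCoprime.prod_right fun j hj => (hq.2 j hj).1

theorem hasEigenvalue_of_isRoot_of_minpoly_ne_zero {f : Module.End K V} {μ : K}
    (hf : minpoly K f ≠ 0) (hμ : (minpoly K f).IsRoot μ) : f.HasEigenvalue μ := by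
  obtain ⟨q, hq⟩ := dvd_iff_isRoot.mpr hμ
  have hq_ne : q ≠ 0 := right_ne_zero_of_mul (hq ▸ hf)
  obtain ⟨x, hx⟩ : ∃ x, aeval f q x ≠ 0 := by
    by_contra! h
    have hdegree := natDegree_le_of_dvd (minpoly.dvd K f (LinearMap.ext h)) hq_ne
    rw [hq, (monic_X_sub_C μ).natDegree_mul' hq_ne, natDegree_X_sub_C] at hdegree
    lia
  refine Module.End.hasEigenvalue_of_hasEigenvector
    (Module.End.hasEigenvector_iff.mpr ⟨?_, hx⟩)
  simpa [sub_eq_zero, hq] using congr($(minpoly.aeval K f) x)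

theorem finrank_eq_card_of_finrank_eigenspace_eq_one {ι : Type*} [Fintype ι] {f : Module.End K V}
    {μ : ι → K} (hμ : Function.Injective μ) (hf : aeval f (∏ i, (X - C (μ i))) = 0)
    (hone : ∀ i, Module.finrank K (f.eigenspace (μ i)) = 1) :
    Module.finrank K V = Fintype.card ι := by
  choose v hv hspan using fun i => finrank_eq_one_iff'.mp (hone i)
  have hli : LinearIndependent K fun i => (v i : V) :=
    Module.End.eigenvectors_linearIndependent' f μ hμ _ fun i =>
      ⟨(v i).2, Subtype.coe_ne_coe.mpr (hv i)⟩
  have hker (i : ι) : LinearMap.ker (aeval f (X - C (μ i))) ≤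
      Submodule.span K (Set.range fun i => (v i : V)) := fun x hx => by
    obtain ⟨c, hc⟩ := hspan i ⟨x, Module.End.mem_eigenspace_iff.mpr
      (by simpa [sub_eq_zero] using hx)⟩
    have hxv : c • (v i : V) = x := congrArg Subtype.val hc
    exact hxv ▸ Submodule.smul_mem _ c (Submodule.subset_span ⟨i, rfl⟩)
  have htop : ⊤ ≤ Submodule.span K (Set.range fun i => (v i : V)) := by
    rw [← LinearMap.ker_eq_top.mpr hf, ker_aeval_prod_of_pairwise_isCoprime f
      fun i _ j _ hij => pairwise_coprime_X_sub_C hμ hij]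
    exact iSup₂_le fun i _ => hker i
  exact Module.finrank_eq_card_basis (Module.Basis.mk hli htop)

end Eigenspace

theorem X_pow_char_sub_X_eq_prod (K : Type*) [Field K] (p : ℕ) [Fact p.Prime] [CharP K p] :
    (X ^ p - X : K[X]) = ∏ a : ZMod p, (X - C (ZMod.castHom (dvd_refl p) K a)) := by
  have hp := (Fact.out : p.Prime).one_lt
  have hmonic : (X ^ p - X : (ZMod p)[X]).Monic :=
    monic_X_pow_sub (by rw [degree_X]; exact_mod_cast hp)
  have hroots : (X ^ p - X : (ZMod p)[X]).roots = Finset.univ.val := by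
    simpa only [ZMod.card] using FiniteField.roots_X_pow_card_sub_X (ZMod p)
  have hprod : ∏ a : ZMod p, (X - C a) = X ^ p - X := by
    have h := prod_multiset_X_sub_C_of_monic_of_roots_card_eq hmonic
    rw [hroots, FiniteField.X_pow_card_sub_X_natDegree_eq _ hp] at h
    exact h (ZMod.card p)
  simpa [Polynomial.map_prod] using
    congrArg (Polynomial.map (ZMod.castHom (dvd_refl p) K)) hprod.symm

section Centre

variable {C D : Type*} [Field C] [DivisionRing D] [Algebra C D]

instance (δ : RingDerivation D) : IsScalarTower (constants C δ) C D :=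
  ⟨fun a b c => by rw [Subfield.smul_def, Subfield.smul_def, smul_eq_mul, mul_smul]⟩

variable [Algebra.IsCentral C D] {δ : RingDerivation D}

theorem exists_mem_constants_algebraMap_eq_iff {d : D} :
    (∃ c ∈ constants C δ, algebraMap C D c = d) ↔ δ d = 0 ∧ ∀ a, a * d = d * a := by
  constructor
  · rintro ⟨c, hc, rfl⟩
    exact ⟨hc, fun a => (Algebra.commutes c a).symm⟩
  · rintro ⟨hd, hcomm⟩
    obtain ⟨c, rfl⟩ := Algebra.mem_bot.mp
      (Algebra.IsCentral.out (K := C) (Subalgebra.mem_center_iff.mpr hcomm))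
    exact ⟨c, hd, rfl⟩

theorem restrictCentre_mul (a b : C) :
    restrictCentre C δ (a * b) = a * restrictCentre C δ b + restrictCentre C δ a * b := by
  apply (algebraMap C D).injective
  simp only [map_mul, map_add, algebraMap_restrictCentre, δ.leibniz]

theorem restrictCentre_eq_zero_iff {c : C} : restrictCentre C δ c = 0 ↔ c ∈ constants C δ := by
  rw [mem_constants, ← algebraMap_restrictCentre, map_eq_zero (algebraMap C D)]

/-- The quotient of two eigenvectors with the same eigenvalue is a constant. -/
theorem finrank_eigenspace_restrictCentre {a : constants C δ}
    (ha : Module.End.HasEigenvalue (restrictCentre C δ) a) :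
    Module.finrank (constants C δ) (Module.End.eigenspace (restrictCentre C δ) a) = 1 := by
  obtain ⟨w, hw, hw_ne⟩ := ha.exists_hasEigenvector
  rw [Module.End.mem_eigenspace_iff] at hw
  refine finrank_eq_one ⟨w, Module.End.mem_eigenspace_iff.mpr hw⟩
    (Subtype.coe_ne_coe.mp hw_ne) fun ⟨x, hx⟩ => ?_
  rw [Module.End.mem_eigenspace_iff] at hx
  have hquot : restrictCentre C δ (x / w) = 0 := by
    have h := restrictCentre_mul (δ := δ) (x / w) w
    rw [div_mul_cancel₀ x hw_ne, hx, hw, mul_smul_comm, div_mul_cancel₀ x hw_ne,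
      left_eq_add] at h
    exact (mul_eq_zero.mp h).resolve_right hw_ne
  exact ⟨⟨x / w, restrictCentre_eq_zero_iff.mp hquot⟩, Subtype.ext (div_mul_cancel₀ x hw_ne)⟩

theorem finrank_constants (p : ℕ) [Fact p.Prime] [CharP C p]
    (hδ : minpoly (constants C δ) (restrictCentre C δ) = X ^ p - X) :
    Module.finrank (constants C δ) C = p := by
  have : CharP (constants C δ) p :=
    (RingHom.charP_iff (constants C δ).subtype (constants C δ).subtype.injective p).mpr ‹_›
  have hprod := X_pow_char_sub_X_eq_prod (constants C δ) p
  rw [← hδ] at hprod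
  rw [finrank_eq_card_of_finrank_eigenspace_eq_one (RingHom.injective _)
    (hprod ▸ minpoly.aeval _ (restrictCentre C δ)) fun a => ?_, ZMod.card]
  refine finrank_eigenspace_restrictCentre (hasEigenvalue_of_isRoot_of_minpoly_ne_zero ?_ ?_)
  · exact hδ ▸ FiniteField.X_pow_card_sub_X_ne_zero _ (Fact.out : p.Prime).one_lt
  · rw [hprod, IsRoot, eval_prod]
    exact Finset.prod_eq_zero (Finset.mem_univ a) (by simp)

theorem finrank_genDiffAlg (p : ℕ) [Fact p.Prime] [CharP C p] (d : D)
    (hδ : minpoly (constants C δ) (restrictCentre C δ) = X ^ p - X) :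
    Module.finrank (constants C δ) (GenDiffAlg δ p d) = Module.finrank C D * p ^ 2 := by
  rw [← Module.finrank_mul_finrank (constants C δ) D, ← Module.finrank_mul_finrank _ C D,
    finrank_constants p hδ, GenDiffAlg.finrank_eq]
  ring

end Centre

/-! ### The automorphism `t ↦ t - 1` -/

section Automorphism

variable (C : Type*) {D : Type*} [Field C] [DivisionRing D] [Algebra C D]
  (δ : RingDerivation D) (p : ℕ) [Fact p.Prime] [CharP D p] (d : D)

/-- The automorphism `G_{id,-1}` of `(D, δ, d)` over `F`, induced by the translation `t ↦ t - 1`,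
which fixes `t ^ p - t - d`. -/
def translateAut : Aut (constants C δ) (GenDiffAlg δ p d) :=
  ⟨LinearEquiv.restrictScalars (constants C δ)
    ({ Petit.translateEquiv (translate_artinSchreier δ p d) with
      map_smul' := Petit.translateEquiv_const_smul (translate_artinSchreier δ p d) } :
      GenDiffAlg δ p d ≃ₗ[D] GenDiffAlg δ p d),
    Petit.translateEquiv_mul (translate_artinSchreier δ p d)⟩

variable {δ p d}

theorem val_translateAut (x : GenDiffAlg δ p d) :
    ((translateAut C δ p d).1 x).val = DiffPoly.translate (-1) x.val := rfl

theorem translateAut_apply_of_val_eq_const {x : GenDiffAlg δ p d} {a : D}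
    (hx : x.val = const δ a) : (translateAut C δ p d).1 x = x :=
  Petit.val_injective (by rw [val_translateAut, hx, translate_const])

theorem val_translateAut_pow (k : ℕ) (x : GenDiffAlg δ p d) :
    ((translateAut C δ p d ^ k).1 x).val = DiffPoly.translate (-(k : Subring.center D)) x.val := by
  induction k with
  | zero => rw [Nat.cast_zero, neg_zero, DiffPoly.translate_zero, pow_zero]; rfl
  | succ k ih =>
    rw [Nat.cast_succ, neg_add_rev, ← DiffPoly.translate_translate, ← ih, ← val_translateAut C,
      pow_succ']
    rfl

theorem orderOf_translateAut : orderOf (translateAut C δ p d) = p := by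
  refine orderOf_eq_prime ?_ fun h => ?_
  · have hp : (p : Subring.center D) = 0 := Subtype.ext (by simp)
    refine Subtype.ext (LinearEquiv.ext fun x => Petit.val_injective ?_)
    rw [val_translateAut_pow, hp, neg_zero, DiffPoly.translate_zero]
    rfl
  · have ht : (Petit.mk (t δ) : GenDiffAlg δ p d).val = t δ :=
      Petit.val_mk_of_mem_lowDegree (lowDegree_mono ((Fact.out : p.Prime).two_le.trans_eq
        (natDegree_artinSchreier δ p d).symm) t_mem_lowDegree_two)
    have hfix : DiffPoly.translate (-1) (t δ) = t δ := by
      have hval := val_translateAut C (Petit.mk (t δ) : GenDiffAlg δ p d)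
      rw [h, ht] at hval
      exact hval.symm.trans ht
    rw [translate_neg_one_t, sub_eq_self] at hfix
    exact one_ne_zero (const_injective (δ := δ) (by rw [map_one, map_zero, hfix]))

end Automorphism

end DiffAlg

end

theorem mainTheorem3 {C : Type*} {D : Type*} [Field C] [DivisionRing D] [Algebra C D]
    [Algebra.IsCentral C D] [FiniteDimensional C D]
    (p : ℕ) [Fact p.Prime] [CharP C p]
    (n : ℕ) (hn : Module.finrank C D = n ^ 2)
    (δ : DiffAlg.RingDerivation D)
    (hδ : minpoly (DiffAlg.constants C δ) (DiffAlg.restrictCentre C δ) = X ^ p - X)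
    (d : D) :
    -- dimension
    Module.finrank (DiffAlg.constants C δ) (DiffAlg.GenDiffAlg δ p d) = n ^ 2 * p ^ 2 ∧
    -- division algebra
    (DiffAlg.IsDivisionAlgebra (DiffAlg.GenDiffAlg δ p d) ↔
      ∀ z : D, d ≠ DiffAlg.DiffPoly.V δ p z - z) ∧
    (DiffAlg.IsDivisionAlgebra (DiffAlg.GenDiffAlg δ p d) ↔
      ∀ z : D, DiffAlg.DiffPoly.const δ d ≠
        DiffAlg.DiffPoly.t δ ^ p - (DiffAlg.DiffPoly.t δ - DiffAlg.DiffPoly.const δ z) ^ p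
          - DiffAlg.DiffPoly.const δ z) ∧
    -- associativity, when `t ^ p - t` annihilates `δ` on all of `D`
    ((∀ a : D, δ^[p] a = δ a) →
      (DiffAlg.IsAssociativeAlgebra (DiffAlg.GenDiffAlg δ p d) ↔
        ∃ c ∈ DiffAlg.constants C δ, algebraMap C D c = d)) ∧
    -- the automorphism `G_{id,-1}` generates a cyclic group of order `p` and is trivial on `D`
    (∃ g : DiffAlg.Aut (DiffAlg.constants C δ) (DiffAlg.GenDiffAlg δ p d),
      (∀ x : DiffAlg.GenDiffAlg δ p d,
        (g.1 x).val = DiffAlg.DiffPoly.G δ (RingEquiv.refl D) (-1) x.val) ∧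
      (∀ (x : DiffAlg.GenDiffAlg δ p d) (a : D),
        x.val = DiffAlg.DiffPoly.const δ a → g.1 x = x) ∧
      Nat.card (Subgroup.zpowers g) = p) := by
  have : CharP D p := charP_of_injective_algebraMap (algebraMap C D).injective p
  have hFC := DiffAlg.finrank_constants p hδ
  have : FiniteDimensional (DiffAlg.constants C δ) C :=
    Module.finite_of_finrank_pos (hFC ▸ (Fact.out : p.Prime).pos)
  have : FiniteDimensional (DiffAlg.constants C δ) D := Module.Finite.trans C D
  have hdiv : DiffAlg.IsDivisionAlgebra (DiffAlg.GenDiffAlg δ p d) ↔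
      ∀ z : D, d ≠ DiffAlg.DiffPoly.V δ p z - z :=
    DiffAlg.GenDiffAlg.isDivisionAlgebra_iff (C := C)
  refine ⟨hn ▸ DiffAlg.finrank_genDiffAlg p d hδ, hdiv, ?_, fun hδp => ?_,
    DiffAlg.translateAut C δ p d, DiffAlg.val_translateAut C,
    fun x a => DiffAlg.translateAut_apply_of_val_eq_const C, ?_⟩
  · refine hdiv.trans (forall_congr' fun z => not_congr ?_)
    rw [DiffAlg.DiffPoly.sub_const_pow_char, sub_sub_cancel, ← map_sub,
      DiffAlg.DiffPoly.const_injective.eq_iff]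
  · rw [DiffAlg.GenDiffAlg.isAssociativeAlgebra_iff,
      DiffAlg.exists_mem_constants_algebraMap_eq_iff]
    simp only [hδp, sub_self, eq_comm, sub_eq_zero]
  · rw [Nat.card_zpowers, DiffAlg.orderOf_translateAut]
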